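/- Let $(t^1,t^2,z^1,z^2)$ be coordinates on $\mathbb R^4$, let $\mathcal G_2$ be the Abelian Lie algebra spanned by $\partial_{z^1},\partial_{z^2}$, and let $\mathfrak G$ be the pseudogroup of local smooth changes of coordinates that preserve $\mathcal G_2$, i.e. (locally) $\bar t^{\,i}=\phi^i(t)$, $\bar z^{\,i}=\alpha^i_j z^j+\psi^i(t)$ with $\phi,\psi$ smooth, $\det(\partial\phi^i/\partial t^j)\neq0$ and $(\alpha^i_j)\in \mathrm{GL}(2,\mathbb R)$ constant. It acts on the metrics $$\mathbf g=b_{ij}(t)\,dt^i dt^j+2f_{ik}(t)\,dt^i dz^k+h_{kl}(t)\,dz^k dz^l,\qquad b_{ij}=b_{ji},\ h_{kl}=h_{lk},$$ of arbitrary signature with $\det\mathbf g\ne0$ and $\det\mathbf h\neq 0$, where $\mathbf h=(h_{kl})$. Let $J^1\tau$ be the $34$-dimensional space of first-order jets of such metrics, with coordinates $t^i,z^k,b_{ij},f_{ik},h_{kl},b_{ij,s},f_{ik,s},h_{kl,s}$, where a comma denotes the (total) derivative with respect to $t^s$. A first-order scalar differential invariant on an open set $U\subseteq J^1\tau$ is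 a smooth function on $U$ that takes the same value at any two jets in $U$ related by the prolonged action of an element of $\mathfrak G$. Put $f_i^k=f_{is}h^{sk}$, $\tilde g_{ij}=b_{ij}-f_{ik}f_{jl}h^{kl}$, $\sigma=d(\det\mathbf h)/\det\mathbf h$, $\rho=\sigma^2$, $\chi=(dh_{11}\,dh_{22}-dh_{12}\,dh_{12})/\det\mathbf h$ (symmetric products), $\gamma=\chi-\frac14\rho$, and, for a symmetric form $\mu=\mu_{ij}dt^idt^j$, $C_\mu=\mu_{ij}\tilde g^{ij}$ and $Q_\mu=\det(\mu_{ij})/\det\tilde{\mathbf g}$. Put further $$\mathcal C^k=\frac{f^k_{1,2}-f^k_{2,1}}{\sqrt{|\det\tilde{\mathbf g}|}},\qquad \ell_{\mathcal C}=h_{kl}\,\mathcal C^k\mathcal C^l,\qquad \Theta_{\mathrm I}=\frac{1}{|\det\mathbf h|^{1/2}|\det\tilde{\mathbf g}|^{1/2}}\begin{vmatrix}h_{11,1}&h_{12,1}&h_{22,1}\\ h_{11,2}&h_{12,2}&h_{22,2}\\ (\mathcal C^2)^2&-\mathcal C^1\mathcal C^2&(\mathcal C^1)^2\end{vmatrix}.$$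 Then the six functions $C_\rho,\ C_\chi,\ Q_\chi,\ Q_\gamma,\ \ell_{\mathcal C},\ (\Theta_{\mathrm I})^2$ form a maximal system of generically functionally independent first-order scalar differential invariants in the orthogonally intransitive case. That is: 1. each of them is a first-order scalar differential invariant on $J^1\tau$; 2. their differentials are linearly independent (their Jacobian has rank $6$) at every point of an open dense subset of the set of orthogonally intransitive jets, i.e. of the jets in $J^1\tau$ at which the Ehresmann curvature $(f^k_{1,2}-f^k_{2,1})_{k=1,2}$ of the distribution orthogonal to the orbits of $\mathcal G_2$ is nonzero; 3. for every open $U\subseteq J^1\tau$ and every first-order scalar differential invariant $F$ on $U$, the seven functions $C_\rho,C_\chi,Q_\chi,Q_\gamma,\ell_{\mathcal C},(\Theta_{\mathrm I})^2,F$ have linearly dependent differentials at every point of $U$. -/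

import Mathlib

open scoped ContDiff

noncomputable section

namespace KillingJet

/-! ### Adapted coordinates and metrics -/

/-- The coordinate space of adapted coordinates `(t¹, t², z¹, z²)`:
`Sum.inl i` labels `tⁱ` and `Sum.inr k` labels `zᵏ`. -/
abbrev M : Type := Fin 2 ⊕ Fin 2 → ℝ

/-- The coordinates `(t¹, t²)` of a point; they are coordinates on the orbit space. -/
def tCoord (p : M) : Fin 2 → ℝ := fun i => p (Sum.inl i)

/-- The generators `∂/∂zᵏ` of the Abelian algebra `𝒢₂`. -/
def dz (k : Fin 2) : M := Pi.single (Sum.inr k) 1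

/-- The fibre coordinates `(b_{ij}, f_{ik}, h_{kl})` of the bundle `τ`. The families `b` and `h`
are indexed by unordered pairs, so that `b_{21} = b_{12}` and `h_{21} = h_{12}`; the fibre has
dimension `3 + 4 + 3 = 10`. -/
abbrev Coeff : Type :=
  (Sym2 (Fin 2) → ℝ) × (Fin 2 → Fin 2 → ℝ) × (Sym2 (Fin 2) → ℝ)

/-- The matrix `(b_{ij})`. -/
def bMat (c : Coeff) : Matrix (Fin 2) (Fin 2) ℝ := Matrix.of fun i j => c.1 s(i, j)

/-- The matrix `(f_{ik})`. -/
def fMat (c : Coeff) : Matrix (Fin 2) (Fin 2) ℝ := Matrix.of c.2.1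

/-- The matrix `(h_{kl})`. -/
def hMat (c : Coeff) : Matrix (Fin 2) (Fin 2) ℝ := Matrix.of fun k l => c.2.2 s(k, l)

/-- The component matrix of `𝐠 = b_{ij} dtⁱ dtʲ + 2 f_{ik} dtⁱ dzᵏ + h_{kl} dzᵏ dzˡ`. -/
def metric (c : Coeff) : Matrix (Fin 2 ⊕ Fin 2) (Fin 2 ⊕ Fin 2) ℝ :=
  Matrix.fromBlocks (bMat c) (fMat c) (fMat c).transpose (hMat c)

/-- The coefficients `f_i^k = f_{is} h^{sk}`. -/
def fUp (c : Coeff) : Matrix (Fin 2) (Fin 2) ℝ := fMat c * (hMat c)⁻¹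

/-- The orbit metric `g̃_{ij} = b_{ij} - f_{ik} f_{jl} h^{kl}`. -/
def orbitMetric (c : Coeff) : Matrix (Fin 2) (Fin 2) ℝ :=
  bMat c - fMat c * (hMat c)⁻¹ * (fMat c).transpose

/-! ### The pseudogroup of adapted coordinate transformations -/

/-- The Jacobian matrix `∂P^a/∂x^c` of a map `P` of the coordinate space. -/
def jacobian (P : M → M) (p : M) : Matrix (Fin 2 ⊕ Fin 2) (Fin 2 ⊕ Fin 2) ℝ :=
  Matrix.of fun a c => fderiv ℝ P p (Pi.single c 1) a

/-- `P`, with domain `W`, is an element of the pseudogroup `𝔊`: a smooth change of coordinates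
under which the algebra `𝒢₂` generated by `∂/∂z¹, ∂/∂z²` is the algebra generated by
`∂/∂z̄¹, ∂/∂z̄²`, that is, `∂/∂zʲ = αⁱⱼ ∂/∂z̄ⁱ` for a constant invertible matrix `α`.
(It follows that locally `t̄ = φ(t)` and `z̄ = α z + ψ(t)`; in particular the leaves
`t = const` are mapped into the leaves `t̄ = const`.) -/
structure IsAdaptedTransformation (P : M → M) (W : Set M) : Prop where
  isOpen : IsOpen W
  contDiffOn : ContDiffOn ℝ ∞ P W
  injOn : Set.InjOn P W
  det_ne_zero : ∀ p ∈ W, (jacobian P p).det ≠ 0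
  preserves : ∃ α : Matrix (Fin 2) (Fin 2) ℝ, α.det ≠ 0 ∧
    ∀ p ∈ W, ∀ j, fderiv ℝ P p (dz j) = ∑ i, α i j • dz i

/-- The fields of coefficients `s` and `s'` (functions of `t` only, i.e. sections of `τ`), smooth
over `W` and `P W` respectively, are such that `P` carries the metric of `s` on `W` into the metric
of `s'`: the first metric is the pull-back of the second one along `P`. -/
structure Transforms (P : M → M) (W : Set M) (s s' : (Fin 2 → ℝ) → Coeff) : Prop where
  smooth : ∀ p ∈ W, ContDiffAt ℝ ∞ s (tCoord p)
  smooth' : ∀ p ∈ W, ContDiffAt ℝ ∞ s' (tCoord (P p))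
  pullback : ∀ p ∈ W, metric (s (tCoord p)) =
    (jacobian P p).transpose * metric (s' (tCoord (P p))) * jacobian P p

/-! ### First-order jets -/

/-- First-order jets of sections of `τ`: the base point `(t, z)`, the coefficients
`(b_{ij}, f_{ik}, h_{kl})`, and their first derivatives `(b_{ij,s}, f_{ik,s}, h_{kl,s})` with
respect to `tˢ`. The dimension is `4 + 10 + 20 = 34`. -/
abbrev Jet : Type := M × Coeff × (Fin 2 → Coeff)

/-- The coefficients `(b_{ij}, f_{ik}, h_{kl})` at a jet. -/
def coeff (x : Jet) : Coeff := x.2.1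

/-- The `1`-jet at `p` of the section with coefficients `s`. -/
def jetOf (s : (Fin 2 → ℝ) → Coeff) (p : M) : Jet :=
  (p, s (tCoord p), fun i => fderiv ℝ s (tCoord p) (Pi.single i 1))

/-- The total derivative `D_s φ` of a function `φ` of the coefficients, a function on jets. -/
def totalDeriv (s : Fin 2) (φ : Coeff → ℝ) (x : Jet) : ℝ := fderiv ℝ φ (coeff x) (x.2.2 s)

/-- `J¹τ`: the jets of metrics that are nondegenerate and whose restriction to the Killing leaves
is nondegenerate. -/
def J1 : Set Jet := {x | (metric (coeff x)).det ≠ 0 ∧ (hMat (coeff x)).det ≠ 0}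

/-- A first-order scalar differential invariant with domain `U`: a smooth function on `U` that is
invariant under the first prolongation of the action of the pseudogroup. -/
structure IsInvariant (U : Set Jet) (F : Jet → ℝ) : Prop where
  smooth : ContDiffOn ℝ ∞ F U
  invariant : ∀ (P : M → M) (W : Set M) (s s' : (Fin 2 → ℝ) → Coeff),
    IsAdaptedTransformation P W → Transforms P W s s' →
      ∀ p ∈ W, jetOf s p ∈ U → jetOf s' (P p) ∈ U → F (jetOf s' (P p)) = F (jetOf s p)

/-! ### The invariants -/

/-- `det 𝐡` at a jet. -/
def detH (x : Jet) : ℝ := (hMat (coeff x)).det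

/-- `det g̃` at a jet. -/
def detG (x : Jet) : ℝ := (orbitMetric (coeff x)).det

/-- `h_{kl,s}`. -/
def dh (s k l : Fin 2) (x : Jet) : ℝ := totalDeriv s (fun c => hMat c k l) x

/-- The components of the form `σ = d(det 𝐡) / det 𝐡`. -/
def sigma (x : Jet) (i : Fin 2) : ℝ := totalDeriv i (fun c => (hMat c).det) x / detH x

/-- The symmetric form `ρ = σ²`. -/
def rho (x : Jet) : Matrix (Fin 2) (Fin 2) ℝ := Matrix.of fun i j => sigma x i * sigma x j

/-- The symmetric form `χ = (dh₁₁ dh₂₂ - dh₁₂ dh₁₂) / det 𝐡`. -/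
def chi (x : Jet) : Matrix (Fin 2) (Fin 2) ℝ := Matrix.of fun i j =>
  (1 / (2 * detH x)) * (dh i 0 0 x * dh j 1 1 x - dh j 0 1 x * dh i 0 1 x) +
  (1 / (2 * detH x)) * (dh j 0 0 x * dh i 1 1 x - dh i 0 1 x * dh j 0 1 x)

/-- The Cosgrove form `γ = χ - ρ / 4`. -/
def gam (x : Jet) : Matrix (Fin 2) (Fin 2) ℝ := chi x - (1 / 4 : ℝ) • rho x

/-- `C_μ = μ_{ij} g̃^{ij}`. -/
def traceInv (μ : Jet → Matrix (Fin 2) (Fin 2) ℝ) (x : Jet) : ℝ :=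
  ∑ i, ∑ j, μ x i j * (orbitMetric (coeff x))⁻¹ i j

/-- `Q_μ = det μ / det g̃`. -/
def detInv (μ : Jet → Matrix (Fin 2) (Fin 2) ℝ) (x : Jet) : ℝ := (μ x).det / detG x

/-- The Ehresmann curvature of the horizontal distribution `Ξ^⊥`, spanned by
`𝐞_j = ∂/∂tʲ - f_j^k ∂/∂zᵏ`: the components
`D₂ f_1^k - D₁ f_2^k` of `𝐜(∂/∂t¹, ∂/∂t²) = [𝐞₁, 𝐞₂]`. -/
def ehresmann (x : Jet) (k : Fin 2) : ℝ :=
  totalDeriv 1 (fun c => fUp c 0 k) x - totalDeriv 0 (fun c => fUp c 1 k) x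

/-- The components `𝒞ᵏ` of the curvature vector field. -/
def curv (x : Jet) (k : Fin 2) : ℝ := ehresmann x k / Real.sqrt |detG x|

/-- `ℓ_𝒞 = 𝐠(𝒞, 𝒞)`. -/
def ellC (x : Jet) : ℝ := ∑ k, ∑ l, hMat (coeff x) k l * curv x k * curv x l

/-- The semi-invariant `Θ_I`. -/
def thetaI (x : Jet) : ℝ :=
  1 / (Real.sqrt |detH x| * Real.sqrt |detG x|) *
    Matrix.det !![dh 0 0 0 x, dh 0 0 1 x, dh 0 1 1 x;
                  dh 1 0 0 x, dh 1 0 1 x, dh 1 1 1 x;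
                  (curv x 1) ^ 2, -(curv x 0 * curv x 1), (curv x 0) ^ 2]

/-- The system `C_ρ, C_χ, Q_χ, Q_γ, ℓ_𝒞, (Θ_I)²`. -/
def invariants : Fin 6 → Jet → ℝ :=
  ![traceInv rho, traceInv chi, detInv chi, detInv gam, ellC, fun x => thetaI x ^ 2]

/-! ### The orthogonally intransitive case and functional independence -/

/-- The jets in `J¹τ` with nonvanishing Ehresmann curvature, i.e. the jets at which the obstruction
to the integrability of `Ξ^⊥` does not vanish. -/
def intransitiveJ1 : Set Jet := {x | x ∈ J1 ∧ ehresmann x ≠ 0}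

/-- Functional independence at a jet: the differentials of the functions are linearly independent
there, i.e. the Jacobian of the family has rank equal to the number of functions. -/
def FunctionallyIndependentAt {n : ℕ} (F : Fin n → Jet → ℝ) (x : Jet) : Prop :=
  LinearIndependent ℝ fun i => fderiv ℝ (F i) x

/-- Generic functional independence on a set of jets: functional independence at every jet of an
open dense subset. -/
def GenericallyIndependentOn {n : ℕ} (F : Fin n → Jet → ℝ) (U : Set Jet) : Prop :=
  ∃ R : Set Jet, IsOpen R ∧ R ⊆ U ∧ U ⊆ closure R ∧ ∀ x ∈ R, FunctionallyIndependentAt F x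

end KillingJet

end

noncomputable section

namespace KillingJet

/-! ### Coordinate formulas -/

/-! Completing the square gives 𝐠 = g̃ + h(dz + f dt, dz + f dt), where f = (f_i^k) behaves as a
connection over the orbit space. An adapted transformation has Jacobian blocks (A, 0; B, α) with α
constant. Hence h, its derivatives and g̃ transform linearly through A and α, while f_i^k acquires
the gauge term B. Second derivatives of the transformation could reach the invariants only through
the derivatives of f_i^k, where their contribution is symmetric in the two lower indices; the
curvature is the antisymmetric part. In the six functions the remaining weights det A and det α
cancel; for Θ_I they cancel only up to sign, whence the square.

Six is the generic codimension of the orbits: 2-jets of adapted transformations have 4 + 12 + 12 =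
28 infinitesimal parameters, against 34 jet coordinates. Orbit directions are realized by
one-parameter families of quadratic transformations, and differentials of invariants annihilate them
(`IsInvariant.fderiv_tangent`). By `eq_zero_of_tangent_of_transversal`, at a regular jet a covector
annihilating the orbit directions and six further vectors is zero. Seven invariants therefore have a
linear relation between their differentials there. The elimination is triangular: second derivatives
of t̄ handle b_{ij,s}, those of z̄ the symmetric part of f_{ik,s}, and the first-order parameters
handle b, f, h and what remains of h_{kl,2}.

Independence (`GenericAt.functionallyIndependentAt`) is tested on the same six vectors. Genericity
is the nonvanishing of a polynomial on the whole vector space of jets that is nonzero at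
`exampleJet`, hence an open dense condition. Since independence is an open condition too, seven
invariants that were independent at one jet would be independent at a regular one; so dependence
holds everywhere. -/

lemma hMat_symm (c : Coeff) : hMat c 1 0 = hMat c 0 1 := by
  simp [hMat, Sym2.eq_swap (a := (1 : Fin 2))]

lemma bMat_symm (c : Coeff) : bMat c 1 0 = bMat c 0 1 := by
  simp [bMat, Sym2.eq_swap (a := (1 : Fin 2))]

lemma hMat_transpose (c : Coeff) : (hMat c).transpose = hMat c := by
  ext i j; simp [hMat, Sym2.eq_swap (a := j)]

lemma bMat_transpose (c : Coeff) : (bMat c).transpose = bMat c := by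
  ext i j; simp [bMat, Sym2.eq_swap (a := j)]

/-- The entry `(k, l)` of `hMat` as a linear form. -/
def hEntry (k l : Fin 2) : Coeff →L[ℝ] ℝ :=
  (ContinuousLinearMap.proj s(k, l)).comp
    ((ContinuousLinearMap.snd ℝ _ _).comp (ContinuousLinearMap.snd ℝ _ _))

/-- The entry `(i, k)` of `fMat` as a linear form. -/
def fEntry (i k : Fin 2) : Coeff →L[ℝ] ℝ :=
  (ContinuousLinearMap.proj k).comp ((ContinuousLinearMap.proj (φ := fun _ : Fin 2 => Fin 2 → ℝ) i).comp
    ((ContinuousLinearMap.fst ℝ _ _).comp (ContinuousLinearMap.snd ℝ _ _)))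

lemma hEntry_apply (k l : Fin 2) (c : Coeff) : hEntry k l c = hMat c k l := rfl

lemma fEntry_apply (i k : Fin 2) (c : Coeff) : fEntry i k c = fMat c i k := rfl

lemma hasFDerivAt_hMat (k l : Fin 2) (c : Coeff) :
    HasFDerivAt (fun c => hMat c k l) (hEntry k l) c := (hEntry k l).hasFDerivAt

lemma hasFDerivAt_fMat (k l : Fin 2) (c : Coeff) :
    HasFDerivAt (fun c => fMat c k l) (fEntry k l) c := (fEntry k l).hasFDerivAt

@[fun_prop]
lemma contDiff_hMat {n : WithTop ℕ∞} (k l : Fin 2) : ContDiff ℝ n (fun c => hMat c k l) :=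
  (hEntry k l).contDiff

@[fun_prop]
lemma contDiff_fMat {n : WithTop ℕ∞} (k l : Fin 2) : ContDiff ℝ n (fun c => fMat c k l) :=
  (fEntry k l).contDiff

@[fun_prop]
lemma contDiff_bMat {n : WithTop ℕ∞} (k l : Fin 2) : ContDiff ℝ n (fun c => bMat c k l) := by
  unfold bMat; simp only [Matrix.of_apply]; fun_prop

lemma dh_eq (s k l : Fin 2) (x : Jet) : dh s k l x = hMat (x.2.2 s) k l := by
  simp only [dh, totalDeriv, (hasFDerivAt_hMat k l _).fderiv, hEntry_apply]

/-- The polarization of the determinant of `2 × 2` matrices, normalized by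
`polar m m = 2 * det m`. -/
def polar (m n : Matrix (Fin 2) (Fin 2) ℝ) : ℝ :=
  m 0 0 * n 1 1 + m 1 1 * n 0 0 - m 0 1 * n 1 0 - m 1 0 * n 0 1

lemma sigma_eq (x : Jet) (i : Fin 2) :
    sigma x i = polar (hMat (coeff x)) (hMat (x.2.2 i)) / detH x := by
  unfold sigma totalDeriv
  congr 1
  simp only [Matrix.det_fin_two]
  have h := ((hasFDerivAt_hMat 0 0 (coeff x)).mul (hasFDerivAt_hMat 1 1 (coeff x))).sub
      ((hasFDerivAt_hMat 0 1 (coeff x)).mul (hasFDerivAt_hMat 1 0 (coeff x)))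
  erw [h.fderiv]
  simp [hEntry_apply, polar]
  ring

lemma chi_eq (x : Jet) (i j : Fin 2) :
    chi x i j = polar (hMat (x.2.2 i)) (hMat (x.2.2 j)) / (2 * detH x) := by
  simp only [chi, dh_eq, polar, hMat_symm, Matrix.of_apply]
  ring

lemma inv_hMat (c : Coeff) : (hMat c)⁻¹ =
    (hMat c).det⁻¹ • !![hMat c 1 1, -hMat c 0 1; -hMat c 1 0, hMat c 0 0] := by
  rw [Matrix.inv_def, Matrix.adjugate_fin_two, Ring.inverse_eq_inv']

lemma fUp_apply (c : Coeff) (i : Fin 2) : fUp c i 0 =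
      (fMat c i 0 * hMat c 1 1 - fMat c i 1 * hMat c 0 1) / (hMat c).det ∧ fUp c i 1 =
      (fMat c i 1 * hMat c 0 0 - fMat c i 0 * hMat c 0 1) / (hMat c).det := by
  constructor <;>
  · simp [fUp, inv_hMat, Matrix.mul_apply, Fin.sum_univ_two, hMat_symm]
    ring

@[fun_prop]
lemma contDiff_det_hMat {n : WithTop ℕ∞} : ContDiff ℝ n (fun c => (hMat c).det) := by
  simp only [Matrix.det_fin_two]; fun_prop

lemma contDiffAt_fUp {n : WithTop ℕ∞} (i k : Fin 2) {c : Coeff} (hc : (hMat c).det ≠ 0) :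
    ContDiffAt ℝ n (fun c => fUp c i k) c := by
  fin_cases k
  · simp only [Fin.zero_eta, (fUp_apply _ i).1]
    exact ContDiffAt.div (by fun_prop) contDiff_det_hMat.contDiffAt hc
  · simp only [Fin.mk_one, (fUp_apply _ i).2]
    exact ContDiffAt.div (by fun_prop) contDiff_det_hMat.contDiffAt hc

lemma fUp_mul_hMat {c : Coeff} (hc : (hMat c).det ≠ 0) : fUp c * hMat c = fMat c := by
  rw [fUp, Matrix.mul_assoc, Matrix.nonsing_inv_mul _ (by simpa using hc), mul_one]

/-- The matrix `D_s f_i^k`. -/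
def dfUp (s : Fin 2) (x : Jet) : Matrix (Fin 2) (Fin 2) ℝ :=
  Matrix.of fun i k => totalDeriv s (fun c => fUp c i k) x

/-- Product rule applied to f_i^k h_{kl} = f_{il}; it gives D_s f_i^k without differentiating the
inverse of h. -/
lemma dfUp_mul {x : Jet} (hx : (hMat (coeff x)).det ≠ 0) (s : Fin 2) :
    dfUp s x * hMat (coeff x) + fUp (coeff x) * hMat (x.2.2 s) = fMat (x.2.2 s) := by
  ext i k
  have hd (l : Fin 2) := ((contDiffAt_fUp (n := 1) i l hx).differentiableAt (by simp)).hasFDerivAt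
  have h1 := ((hd 0).mul (hasFDerivAt_hMat 0 k (coeff x))).add
    ((hd 1).mul (hasFDerivAt_hMat 1 k (coeff x)))
  have h2 : (fun c => fMat c i k) =ᶠ[nhds (coeff x)]
      fun c => fUp c i 0 * hMat c 0 k + fUp c i 1 * hMat c 1 k := by
    have : ∀ᶠ c in nhds (coeff x), (hMat c).det ≠ 0 :=
      (contDiff_det_hMat (n := 0)).continuous.continuousAt.eventually_ne hx
    filter_upwards [this] with c hc
    conv_lhs => rw [← fUp_mul_hMat hc]
    simp [Matrix.mul_apply]
  have h3 := (h1.congr_of_eventuallyEq h2).unique (hasFDerivAt_fMat i k (coeff x))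
  have h4 := DFunLike.congr_fun h3 (x.2.2 s)
  rw [fEntry_apply] at h4
  rw [← h4]
  simp [Matrix.mul_apply, Fin.sum_univ_two, dfUp, totalDeriv, hEntry_apply]
  ring

lemma dfUp_eq {x : Jet} (hx : (hMat (coeff x)).det ≠ 0) (s : Fin 2) :
    dfUp s x = (fMat (x.2.2 s) - fUp (coeff x) * hMat (x.2.2 s)) * (hMat (coeff x))⁻¹ := by
  rw [← dfUp_mul hx s, add_sub_cancel_right, Matrix.mul_assoc,
    Matrix.mul_nonsing_inv _ (by simpa using hx), mul_one]

lemma ehresmann_eq (x : Jet) (k : Fin 2) : ehresmann x k = dfUp 1 x 0 k - dfUp 0 x 1 k := rfl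

/-- The orbit metric is the Schur complement of the block h. -/
lemma det_metric {c : Coeff} (hc : (hMat c).det ≠ 0) :
    (metric c).det = (hMat c).det * (orbitMetric c).det := by
  have : Invertible (hMat c) := Matrix.invertibleOfIsUnitDet _ (by simpa using hc)
  rw [metric, Matrix.det_fromBlocks₂₂, Matrix.invOf_eq_nonsing_inv, orbitMetric]

lemma detG_ne_zero {x : Jet} (hx : x ∈ J1) : detG x ≠ 0 := by
  have h := hx.1
  rw [det_metric hx.2] at h
  exact right_ne_zero_of_mul h

lemma detH_ne_zero {x : Jet} (hx : x ∈ J1) : detH x ≠ 0 := hx.2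

lemma orbitMetric_apply (c : Coeff) (i j : Fin 2) : orbitMetric c i j =
    bMat c i j - (fMat c i 0 * fMat c j 0 * hMat c 1 1 - fMat c i 0 * fMat c j 1 * hMat c 0 1 -
      fMat c i 1 * fMat c j 0 * hMat c 0 1 + fMat c i 1 * fMat c j 1 * hMat c 0 0) /
      (hMat c).det := by
  simp [orbitMetric, inv_hMat, Matrix.mul_apply, Fin.sum_univ_two, hMat_symm]
  ring

lemma orbitMetric_symm (c : Coeff) : orbitMetric c 1 0 = orbitMetric c 0 1 := by
  simp only [orbitMetric_apply, bMat_symm]; ring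

lemma isOpen_J1 : IsOpen J1 := by
  have h1 : Continuous fun x : Jet => (metric (coeff x)).det := by
    refine Continuous.matrix_det ?_
    unfold metric coeff bMat fMat hMat
    refine Continuous.matrix_fromBlocks ?_ ?_ ?_ ?_ <;>
      exact continuous_matrix fun i j => by simp only [Matrix.transpose_apply, Matrix.of_apply]; fun_prop
  have h2 : Continuous fun x : Jet => (hMat (coeff x)).det :=
    (contDiff_det_hMat (n := 0)).continuous.comp (by unfold coeff; fun_prop)
  exact (isOpen_ne_fun h1 continuous_const).inter (isOpen_ne_fun h2 continuous_const)

section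

/-! ### Smoothness of the invariants -/

@[fun_prop]
lemma contDiff_hMat_coeff {n : WithTop ℕ∞} (k l : Fin 2) :
    ContDiff ℝ n (fun x : Jet => hMat (coeff x) k l) :=
  (contDiff_hMat k l).comp (by unfold coeff; fun_prop)

@[fun_prop]
lemma contDiff_fMat_coeff {n : WithTop ℕ∞} (k l : Fin 2) :
    ContDiff ℝ n (fun x : Jet => fMat (coeff x) k l) :=
  (contDiff_fMat k l).comp (by unfold coeff; fun_prop)

@[fun_prop]
lemma contDiff_bMat_coeff {n : WithTop ℕ∞} (k l : Fin 2) :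
    ContDiff ℝ n (fun x : Jet => bMat (coeff x) k l) :=
  (contDiff_bMat k l).comp (by unfold coeff; fun_prop)

@[fun_prop]
lemma contDiff_hMat_deriv {n : WithTop ℕ∞} (s k l : Fin 2) :
    ContDiff ℝ n (fun x : Jet => hMat (x.2.2 s) k l) :=
  (contDiff_hMat k l).comp (by fun_prop)

@[fun_prop]
lemma contDiff_fMat_deriv {n : WithTop ℕ∞} (s k l : Fin 2) :
    ContDiff ℝ n (fun x : Jet => fMat (x.2.2 s) k l) :=
  (contDiff_fMat k l).comp (by fun_prop)

@[fun_prop]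
lemma contDiff_detH {n : WithTop ℕ∞} : ContDiff ℝ n detH :=
  contDiff_det_hMat.comp (by unfold coeff; fun_prop)

variable {n : ℕ∞} {x : Jet}

lemma contDiffAt_orbitMetric (hx : x ∈ J1) (i j : Fin 2) :
    ContDiffAt ℝ n (fun x => orbitMetric (coeff x) i j) x := by
  simp only [orbitMetric_apply]
  exact ContDiffAt.sub (ContDiff.contDiffAt (by fun_prop))
    (ContDiffAt.div (ContDiff.contDiffAt (by fun_prop)) contDiff_detH.contDiffAt (detH_ne_zero hx))

lemma contDiffAt_detG (hx : x ∈ J1) : ContDiffAt ℝ n detG x := by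
  unfold detG
  simp only [Matrix.det_fin_two]
  have h (i j : Fin 2) := contDiffAt_orbitMetric (n := n) hx i j
  exact ((h 0 0).mul (h 1 1)).sub ((h 0 1).mul (h 1 0))

lemma inv_orbitMetric (c : Coeff) : (orbitMetric c)⁻¹ =
    (orbitMetric c).det⁻¹ •
      !![orbitMetric c 1 1, -orbitMetric c 0 1; -orbitMetric c 1 0, orbitMetric c 0 0] := by
  rw [Matrix.inv_def, Matrix.adjugate_fin_two, Ring.inverse_eq_inv']

lemma contDiffAt_inv_orbitMetric (hx : x ∈ J1) (i j : Fin 2) :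
    ContDiffAt ℝ n (fun x => (orbitMetric (coeff x))⁻¹ i j) x := by
  simp only [inv_orbitMetric, Matrix.smul_apply, smul_eq_mul]
  refine ((contDiffAt_detG hx).inv (detG_ne_zero hx)).mul ?_
  have h (i j : Fin 2) := contDiffAt_orbitMetric (n := n) hx i j
  fin_cases i <;> fin_cases j
  exacts [h 1 1, (h 0 1).neg, (h 1 0).neg, h 0 0]

lemma contDiffAt_sigma (hx : x ∈ J1) (i : Fin 2) : ContDiffAt ℝ n (fun x => sigma x i) x := by
  simp only [sigma_eq, polar]
  exact ContDiffAt.div (ContDiff.contDiffAt (by fun_prop)) contDiff_detH.contDiffAt (detH_ne_zero hx)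

lemma contDiffAt_rho (hx : x ∈ J1) (i j : Fin 2) : ContDiffAt ℝ n (fun x => rho x i j) x :=
  (contDiffAt_sigma hx i).mul (contDiffAt_sigma hx j)

lemma contDiffAt_chi (hx : x ∈ J1) (i j : Fin 2) : ContDiffAt ℝ n (fun x => chi x i j) x := by
  simp only [chi_eq, polar]
  exact ContDiffAt.div (ContDiff.contDiffAt (by fun_prop)) (contDiff_const.mul contDiff_detH).contDiffAt
    (mul_ne_zero two_ne_zero (detH_ne_zero hx))

lemma contDiffAt_gam (hx : x ∈ J1) (i j : Fin 2) : ContDiffAt ℝ n (fun x => gam x i j) x :=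
  (contDiffAt_chi hx i j).sub (contDiffAt_const.mul (contDiffAt_rho hx i j))

lemma contDiffAt_traceInv {μ : Jet → Matrix (Fin 2) (Fin 2) ℝ} (hx : x ∈ J1)
    (hμ : ∀ i j, ContDiffAt ℝ n (fun x => μ x i j) x) : ContDiffAt ℝ n (traceInv μ) x :=
  ContDiffAt.sum fun i _ => ContDiffAt.sum fun j _ =>
    (hμ i j).mul (contDiffAt_inv_orbitMetric hx i j)

lemma contDiffAt_detInv {μ : Jet → Matrix (Fin 2) (Fin 2) ℝ} (hx : x ∈ J1)
    (hμ : ∀ i j, ContDiffAt ℝ n (fun x => μ x i j) x) : ContDiffAt ℝ n (detInv μ) x := by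
  unfold detInv
  simp only [Matrix.det_fin_two]
  exact (((hμ 0 0).mul (hμ 1 1)).sub ((hμ 0 1).mul (hμ 1 0))).div (contDiffAt_detG hx)
    (detG_ne_zero hx)

lemma contDiffAt_fUp_coeff (hx : x ∈ J1) (i k : Fin 2) :
    ContDiffAt ℝ n (fun x => fUp (coeff x) i k) x :=
  ContDiffAt.comp x (contDiffAt_fUp i k hx.2) (by unfold coeff; fun_prop)

/-- Near a jet of `J1` the total derivative is a rational expression in the jet coordinates, from
which smoothness is read off. -/
lemma contDiffAt_dfUp (hx : x ∈ J1) (s i k : Fin 2) :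
    ContDiffAt ℝ n (fun x => dfUp s x i k) x := by
  have h : (fun x => dfUp s x i k) =ᶠ[nhds x] fun x =>
      ∑ l, (fMat (x.2.2 s) i l - ∑ m, fUp (coeff x) i m * hMat (x.2.2 s) m l) *
        ((detH x)⁻¹ * !![hMat (coeff x) 1 1, -hMat (coeff x) 0 1;
          -hMat (coeff x) 1 0, hMat (coeff x) 0 0] l k) := by
    filter_upwards [isOpen_J1.mem_nhds hx] with y hy
    rw [dfUp_eq hy.2, inv_hMat]
    simp only [Matrix.mul_apply, Matrix.sub_apply, Matrix.smul_apply, smul_eq_mul]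
    rfl
  refine ContDiffAt.congr_of_eventuallyEq ?_ h
  refine ContDiffAt.sum fun l _ => ContDiffAt.mul (ContDiffAt.sub
    (contDiff_fMat_deriv s i l).contDiffAt (ContDiffAt.sum fun m _ =>
      (contDiffAt_fUp_coeff hx i m).mul (contDiff_hMat_deriv s m l).contDiffAt))
    ((contDiff_detH.contDiffAt.inv (detH_ne_zero hx)).mul ?_)
  fin_cases l <;> fin_cases k <;> simp <;> exact ContDiff.contDiffAt (by fun_prop)

lemma contDiffAt_ehresmann (hx : x ∈ J1) (k : Fin 2) :
    ContDiffAt ℝ n (fun x => ehresmann x k) x := by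
  simp only [ehresmann_eq]
  exact (contDiffAt_dfUp hx 1 0 k).sub (contDiffAt_dfUp hx 0 1 k)

lemma contDiffAt_sqrt_abs {f : Jet → ℝ} (hf : ContDiffAt ℝ n f x) (h0 : f x ≠ 0) :
    ContDiffAt ℝ n (fun x => Real.sqrt |f x|) x :=
  (ContDiffAt.comp x (contDiffAt_abs h0) hf).sqrt (abs_ne_zero.mpr h0)

lemma contDiffAt_curv (hx : x ∈ J1) (k : Fin 2) : ContDiffAt ℝ n (fun x => curv x k) x :=
  (contDiffAt_ehresmann hx k).div (contDiffAt_sqrt_abs (contDiffAt_detG hx) (detG_ne_zero hx))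
    (Real.sqrt_ne_zero'.mpr (abs_pos.mpr (detG_ne_zero hx)))

lemma contDiffAt_ellC (hx : x ∈ J1) : ContDiffAt ℝ n ellC x :=
  ContDiffAt.sum fun k _ => ContDiffAt.sum fun l _ =>
    ((contDiff_hMat_coeff k l).contDiffAt.mul (contDiffAt_curv hx k)).mul (contDiffAt_curv hx l)

lemma contDiffAt_thetaI (hx : x ∈ J1) : ContDiffAt ℝ n thetaI x := by
  have h0 := contDiffAt_curv (n := n) hx 0
  have h1 := contDiffAt_curv (n := n) hx 1
  unfold thetaI
  simp only [Matrix.det_fin_three, dh_eq]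
  refine ContDiffAt.mul ?_ ?_
  · refine contDiffAt_const.div ((contDiffAt_sqrt_abs contDiff_detH.contDiffAt
      (detH_ne_zero hx)).mul (contDiffAt_sqrt_abs (contDiffAt_detG hx) (detG_ne_zero hx))) ?_
    exact mul_ne_zero (Real.sqrt_ne_zero'.mpr (abs_pos.mpr (detH_ne_zero hx)))
      (Real.sqrt_ne_zero'.mpr (abs_pos.mpr (detG_ne_zero hx)))
  · have h (s k l : Fin 2) := (contDiff_hMat_deriv (n := n) s k l).contDiffAt (x := x)
    simp
    fun_prop

lemma contDiffAt_invariants (hx : x ∈ J1) (i : Fin 6) : ContDiffAt ℝ n (invariants i) x := by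
  fin_cases i
  · exact contDiffAt_traceInv hx (contDiffAt_rho hx)
  · exact contDiffAt_traceInv hx (contDiffAt_chi hx)
  · exact contDiffAt_detInv hx (contDiffAt_chi hx)
  · exact contDiffAt_detInv hx (contDiffAt_gam hx)
  · exact contDiffAt_ellC hx
  · exact (contDiffAt_thetaI hx).pow 2

end

section

/-! ### The prolonged action of the pseudogroup -/

/-- The entries of `metric` as linear forms. -/
def metricEntry (a b : Fin 2 ⊕ Fin 2) : Coeff →L[ℝ] ℝ :=
  LinearMap.toContinuousLinearMap
    { toFun := fun c => metric c a b
      map_add' := fun c c' => by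
        rcases a with a | a <;> rcases b with b | b <;> simp [metric, bMat, fMat, hMat]
      map_smul' := fun r c => by
        rcases a with a | a <;> rcases b with b | b <;> simp [metric, bMat, fMat, hMat] }

lemma metricEntry_apply (a b : Fin 2 ⊕ Fin 2) (c : Coeff) : metricEntry a b c = metric c a b := rfl

lemma two_le_infty : (1 + 1 : WithTop ℕ∞) ≤ ∞ :=
  WithTop.coe_le_coe.mpr (le_top : (1 + 1 : ℕ∞) ≤ ⊤)

lemma two_le_infty' : (2 : WithTop ℕ∞) ≤ ∞ :=
  WithTop.coe_le_coe.mpr (le_top : (2 : ℕ∞) ≤ ⊤)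

/-- The derivative `∂/∂tˢ` of the Jacobian matrix of `P`. -/
def hessian (P : M → M) (p : M) (s : Fin 2) : Matrix (Fin 2 ⊕ Fin 2) (Fin 2 ⊕ Fin 2) ℝ :=
  Matrix.of fun a c =>
    fderiv ℝ (fderiv ℝ P) p (Pi.single (Sum.inl s) 1) (Pi.single c 1) a

lemma hasDerivAt_line (p e : M) : HasDerivAt (fun ε : ℝ => p + ε • e) e 0 := by
  simpa using ((hasDerivAt_id (0 : ℝ)).smul_const e).const_add p

lemma tendsto_line (p e : M) : Filter.Tendsto (fun ε : ℝ => p + ε • e) (nhds 0) (nhds p) := by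
  simpa using (hasDerivAt_line p e).continuousAt.tendsto

lemma hasDerivAt_jacobian {P : M → M} {p : M} (hP : ContDiffAt ℝ ∞ P p) (s : Fin 2)
    (a c : Fin 2 ⊕ Fin 2) :
    HasDerivAt (fun ε : ℝ => jacobian P (p + ε • Pi.single (Sum.inl s) 1) a c)
      (hessian P p s a c) 0 := by
  have h1 : HasFDerivAt (fderiv ℝ P) (fderiv ℝ (fderiv ℝ P) p) (p + (0 : ℝ) • Pi.single (Sum.inl s) 1) := by
    simpa using ((hP.fderiv_right (m := 1) two_le_infty).differentiableAt (by simp)).hasFDerivAt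
  have h2 := h1.comp_hasDerivAt (0 : ℝ) (hasDerivAt_line p (Pi.single (Sum.inl s) 1))
  have h3 := h2.clm_apply (hasDerivAt_const (0 : ℝ) (Pi.single c 1 : M))
  have h4 := (hasDerivAt_pi.mp h3) a
  simpa [jacobian, hessian] using h4

lemma tCoord_hasDerivAt {γ : ℝ → M} {v : M} {ε : ℝ} (h : HasDerivAt γ v ε) :
    HasDerivAt (fun ε => tCoord (γ ε)) (tCoord v) ε :=
  hasDerivAt_pi.mpr fun i => (hasDerivAt_pi.mp h) (Sum.inl i)

variable {P : M → M} {W : Set M} {s s' : (Fin 2 → ℝ) → Coeff} {p : M}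

lemma hasDerivAt_metric_source (hs : ContDiffAt ℝ ∞ s (tCoord p)) (i : Fin 2)
    (a b : Fin 2 ⊕ Fin 2) :
    HasDerivAt (fun ε : ℝ => metric (s (tCoord (p + ε • Pi.single (Sum.inl i) 1))) a b)
      (metric ((jetOf s p).2.2 i) a b) 0 := by
  have h1 : HasFDerivAt s (fderiv ℝ s (tCoord p))
      (tCoord (p + (0 : ℝ) • Pi.single (Sum.inl i) 1)) := by
    simpa using (hs.differentiableAt (by simp)).hasFDerivAt
  have h2 := h1.comp_hasDerivAt (0 : ℝ)
    (tCoord_hasDerivAt (hasDerivAt_line p (Pi.single (Sum.inl i) 1)))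
  have h3 := (metricEntry a b).hasFDerivAt.comp_hasDerivAt (0 : ℝ) h2
  have h4 : tCoord (Pi.single (Sum.inl i) 1) = Pi.single i 1 := by
    ext j; simp [tCoord, Pi.single_apply]
  rw [h4] at h3
  exact h3

lemma hasDerivAt_metric_target (hP : ContDiffAt ℝ ∞ P p)
    (hs : ContDiffAt ℝ ∞ s' (tCoord (P p))) (i : Fin 2) (a b : Fin 2 ⊕ Fin 2) :
    HasDerivAt (fun ε : ℝ => metric (s' (tCoord (P (p + ε • Pi.single (Sum.inl i) 1)))) a b)
      (∑ r, jacobian P p (Sum.inl r) (Sum.inl i) * metric ((jetOf s' (P p)).2.2 r) a b) 0 := by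
  have h0 : HasFDerivAt P (fderiv ℝ P p) (p + (0 : ℝ) • Pi.single (Sum.inl i) 1) := by
    simpa using (hP.differentiableAt (by simp)).hasFDerivAt
  have h1 : HasFDerivAt s' (fderiv ℝ s' (tCoord (P p)))
      (tCoord (P (p + (0 : ℝ) • Pi.single (Sum.inl i) 1))) := by
    simpa using (hs.differentiableAt (by simp)).hasFDerivAt
  have h2 := h1.comp_hasDerivAt (0 : ℝ) (tCoord_hasDerivAt
    (h0.comp_hasDerivAt (0 : ℝ) (hasDerivAt_line p (Pi.single (Sum.inl i) 1))))
  have h3 := (metricEntry a b).hasFDerivAt.comp_hasDerivAt (0 : ℝ) h2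
  refine h3.congr_deriv ?_
  have h4 : tCoord (fderiv ℝ P p (Pi.single (Sum.inl i) 1)) =
      ∑ r, jacobian P p (Sum.inl r) (Sum.inl i) • Pi.single r (1 : ℝ) := by
    ext j
    simp [tCoord, jacobian, Pi.single_apply, Finset.sum_apply]
  rw [h4]
  simp only [map_sum, map_smul, smul_eq_mul, metricEntry_apply]
  rfl

/-- Two jets related by the prolonged action. `A`, `B`, `α` are the blocks of the Jacobian matrix;
`Φ s` and `Ψ s` are those of its derivative with respect to `tˢ`. -/
structure JetRelated (A B α : Matrix (Fin 2) (Fin 2) ℝ) (Φ Ψ : Fin 2 → Matrix (Fin 2) (Fin 2) ℝ)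
    (x x' : Jet) : Prop where
  det_A : A.det ≠ 0
  det_α : α.det ≠ 0
  symm_Φ : ∀ i j k, Φ i k j = Φ j k i
  symm_Ψ : ∀ i j k, Ψ i k j = Ψ j k i
  metric_eq : metric (coeff x) =
    (Matrix.fromBlocks A 0 B α).transpose * metric (coeff x') * Matrix.fromBlocks A 0 B α
  deriv_eq : ∀ s, metric (x.2.2 s) =
    (Matrix.fromBlocks (Φ s) 0 (Ψ s) 0).transpose * metric (coeff x') * Matrix.fromBlocks A 0 B α +
    (Matrix.fromBlocks A 0 B α).transpose * (∑ r, A r s • metric (x'.2.2 r)) *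
      Matrix.fromBlocks A 0 B α +
    (Matrix.fromBlocks A 0 B α).transpose * metric (coeff x') * Matrix.fromBlocks (Φ s) 0 (Ψ s) 0

lemma jacobian_inr {α : Matrix (Fin 2) (Fin 2) ℝ} {q : M}
    (h : ∀ j, fderiv ℝ P q (dz j) = ∑ i, α i j • dz i) (j : Fin 2) :
    (∀ i, jacobian P q (Sum.inl i) (Sum.inr j) = 0) ∧
      ∀ i, jacobian P q (Sum.inr i) (Sum.inr j) = α i j := by
  constructor <;> intro i
  · change fderiv ℝ P q (dz j) (Sum.inl i) = 0
    rw [h]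
    simp [dz]
  · change fderiv ℝ P q (dz j) (Sum.inr i) = α i j
    rw [h]
    simp [dz, Pi.single_apply]

/-- Preservation of the algebra fixes the z-columns of the Jacobian matrix; symmetry of the second
derivative and the Leibniz rule for the pull-back relation along the lines of direction tˢ do the
rest. All transformation laws below are algebraic consequences of `JetRelated`. -/
lemma exists_jetRelated (hP : IsAdaptedTransformation P W) (hT : Transforms P W s s')
    (hp : p ∈ W) : ∃ A B α Φ Ψ, jacobian P p = Matrix.fromBlocks A 0 B α ∧
      (∀ i, hessian P p i = Matrix.fromBlocks (Φ i) 0 (Ψ i) 0) ∧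
      JetRelated A B α Φ Ψ (jetOf s p) (jetOf s' (P p)) := by
  obtain ⟨α, hα, hα'⟩ := hP.preserves
  have hsm : ContDiffAt ℝ ∞ P p := hP.contDiffOn.contDiffAt (hP.isOpen.mem_nhds hp)
  have hW (e : M) : ∀ᶠ ε : ℝ in nhds 0, p + ε • e ∈ W :=
    (tendsto_line p e).eventually (hP.isOpen.mem_nhds hp)
  have hJ : jacobian P p = Matrix.fromBlocks (jacobian P p).toBlocks₁₁ 0
      (jacobian P p).toBlocks₂₁ α := by
    conv_lhs => rw [← Matrix.fromBlocks_toBlocks (jacobian P p)]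
    congr 1
    · ext i j; exact (jacobian_inr (hα' p hp) j).1 i
    · ext i j; exact (jacobian_inr (hα' p hp) j).2 i
  -- The z-columns of the Jacobian matrix are the constants 0 and α, so their derivatives vanish.
  have hH0 (i : Fin 2) (a : Fin 2 ⊕ Fin 2) (j : Fin 2) : hessian P p i a (Sum.inr j) = 0 := by
    refine (hasDerivAt_jacobian hsm i a (Sum.inr j)).unique ?_
    refine (hasDerivAt_const (0 : ℝ) (jacobian P p a (Sum.inr j))).congr_of_eventuallyEq ?_
    filter_upwards [hW (Pi.single (Sum.inl i) 1)] with ε hε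
    rcases a with a | a
    · rw [(jacobian_inr (hα' _ hε) j).1, (jacobian_inr (hα' _ hp) j).1]
    · rw [(jacobian_inr (hα' _ hε) j).2, (jacobian_inr (hα' _ hp) j).2]
  have hH (i : Fin 2) : hessian P p i = Matrix.fromBlocks (hessian P p i).toBlocks₁₁ 0
      (hessian P p i).toBlocks₂₁ 0 := by
    conv_lhs => rw [← Matrix.fromBlocks_toBlocks (hessian P p i)]
    congr 1
    · ext k j; exact hH0 i (Sum.inl k) j
    · ext k j; exact hH0 i (Sum.inr k) j
  have hsymm : IsSymmSndFDerivAt ℝ P p := hsm.isSymmSndFDerivAt (by simpa using two_le_infty')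
  have hHs (i j : Fin 2) (a : Fin 2 ⊕ Fin 2) :
      hessian P p i a (Sum.inl j) = hessian P p j a (Sum.inl i) :=
    congrFun (hsymm (Pi.single (Sum.inl i) 1) (Pi.single (Sum.inl j) 1)) a
  refine ⟨_, _, α, _, _, hJ, hH, ?_, hα, ?_, ?_, ?_, ?_⟩
  · have := hP.det_ne_zero p hp
    rw [hJ, Matrix.det_fromBlocks_zero₁₂] at this
    exact left_ne_zero_of_mul this
  · exact fun i j k => hHs i j (Sum.inl k)
  · exact fun i j k => hHs i j (Sum.inr k)
  · rw [← hJ]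
    exact hT.pullback p hp
  · intro i
    rw [← hJ, ← hH]
    ext a b
    have hL := hasDerivAt_metric_source (hT.smooth p hp) i a b
    have hR : HasDerivAt (fun ε : ℝ => ∑ d, (∑ c,
        jacobian P (p + ε • Pi.single (Sum.inl i) 1) c a *
        metric (s' (tCoord (P (p + ε • Pi.single (Sum.inl i) 1)))) c d) *
        jacobian P (p + ε • Pi.single (Sum.inl i) 1) d b) _ 0 :=
      HasDerivAt.fun_sum fun d _ => HasDerivAt.mul (HasDerivAt.fun_sum fun c _ =>
        (hasDerivAt_jacobian hsm i c a).mul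
          (hasDerivAt_metric_target hsm (hT.smooth' p hp) i c d))
        (hasDerivAt_jacobian hsm i d b)
    have hLR := hL.unique (hR.congr_of_eventuallyEq ?_)
    · rw [hLR]
      simp only [zero_smul, add_zero, Matrix.add_apply, Matrix.mul_apply, Matrix.transpose_apply,
        Matrix.sum_apply, Matrix.smul_apply, smul_eq_mul, Finset.sum_add_distrib, add_mul,
        Matrix.toBlocks₁₁, Matrix.of_apply]
      rfl
    · filter_upwards [hW (Pi.single (Sum.inl i) 1)] with ε hε
      rw [hT.pullback _ hε]
      simp [Matrix.mul_apply]

end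

open Matrix

section

/-! ### Transformation of the reduced data -/

variable {A B α : Matrix (Fin 2) (Fin 2) ℝ} {Φ Ψ : Fin 2 → Matrix (Fin 2) (Fin 2) ℝ} {x x' : Jet}

lemma JetRelated.blocks (h : JetRelated A B α Φ Ψ x x') :
    hMat (coeff x) = αᵀ * hMat (coeff x') * α ∧
    fMat (coeff x) = Aᵀ * fMat (coeff x') * α + Bᵀ * hMat (coeff x') * α ∧
    bMat (coeff x) = Aᵀ * bMat (coeff x') * A + Bᵀ * (fMat (coeff x'))ᵀ * A +
      Aᵀ * fMat (coeff x') * B + Bᵀ * hMat (coeff x') * B := by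
  have h1 := h.metric_eq
  simp only [metric, fromBlocks_transpose, fromBlocks_multiply, fromBlocks_inj, transpose_zero,
    zero_mul, mul_zero, zero_add, Matrix.add_mul] at h1
  obtain ⟨hb, hf, -, hh⟩ := h1
  refine ⟨hh, hf, hb.trans (by abel)⟩

lemma JetRelated.deriv_blocks (h : JetRelated A B α Φ Ψ x x') (s : Fin 2) :
    hMat (x.2.2 s) = αᵀ * (∑ r, A r s • hMat (x'.2.2 r)) * α ∧
    fMat (x.2.2 s) = (Φ s)ᵀ * fMat (coeff x') * α + (Ψ s)ᵀ * hMat (coeff x') * α +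
      Aᵀ * (∑ r, A r s • fMat (x'.2.2 r)) * α + Bᵀ * (∑ r, A r s • hMat (x'.2.2 r)) * α := by
  have h1 := h.deriv_eq s
  simp only [metric, fromBlocks_transpose, fromBlocks_multiply, fromBlocks_inj, transpose_zero,
    zero_mul, mul_zero, zero_add, add_zero, Matrix.add_mul, Fin.sum_univ_two, fromBlocks_smul,
    fromBlocks_add] at h1
  obtain ⟨-, hf, -, hh⟩ := h1
  simp only [Fin.sum_univ_two]
  refine ⟨hh, hf.trans ?_⟩
  noncomm_ring

/-- The gauge law of the connection: substitute f = f^k h on both sides of the block law for f and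
cancel the invertible factors h' and α. -/
lemma JetRelated.fUp_mul (h : JetRelated A B α Φ Ψ x x') (hx : x ∈ J1) (hx' : x' ∈ J1) :
    fUp (coeff x) * αᵀ = Aᵀ * fUp (coeff x') + Bᵀ := by
  obtain ⟨hh, hf, -⟩ := h.blocks
  have hα : IsUnit α := (isUnit_iff_isUnit_det _).mpr h.det_α.isUnit
  have hh' : IsUnit (hMat (coeff x')) := (isUnit_iff_isUnit_det _).mpr (Ne.isUnit hx'.2)
  have h1 := fUp_mul_hMat hx.2
  rw [hh, hf, ← fUp_mul_hMat hx'.2] at h1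
  refine hh'.mul_right_cancel (hα.mul_right_cancel ?_)
  simpa only [Matrix.mul_assoc, Matrix.add_mul] using h1

/-- The total derivative of the gauge law; Φ and Ψ are the derivatives of A and B, and α contributes
nothing because it is constant. -/
lemma JetRelated.dfUp_mul (h : JetRelated A B α Φ Ψ x x') (hx : x ∈ J1) (hx' : x' ∈ J1)
    (s : Fin 2) : dfUp s x * αᵀ =
      (Φ s)ᵀ * fUp (coeff x') + (Ψ s)ᵀ + Aᵀ * ∑ r, A r s • dfUp r x' := by
  have hα : IsUnit α := (isUnit_iff_isUnit_det _).mpr h.det_α.isUnit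
  have hh' : IsUnit (hMat (coeff x')) := (isUnit_iff_isUnit_det _).mpr (Ne.isUnit hx'.2)
  refine hh'.mul_right_cancel (hα.mul_right_cancel ?_)
  have h1 := eq_sub_of_add_eq (KillingJet.dfUp_mul hx.2 s)
  rw [(h.deriv_blocks s).1, (h.deriv_blocks s).2, h.blocks.1] at h1
  have h2 : dfUp s x * αᵀ * hMat (coeff x') * α = dfUp s x * (αᵀ * hMat (coeff x') * α) := by
    simp only [Matrix.mul_assoc]
  have h3 : fUp (coeff x) * (αᵀ * (∑ r, A r s • hMat (x'.2.2 r)) * α) =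
      fUp (coeff x) * αᵀ * (∑ r, A r s • hMat (x'.2.2 r)) * α := by
    simp only [Matrix.mul_assoc]
  rw [h2, h1, h3, h.fUp_mul hx hx']
  simp only [← KillingJet.dfUp_mul hx'.2, ← fUp_mul_hMat hx'.2, Fin.sum_univ_two]
  simp only [smul_add, Matrix.add_mul, Matrix.mul_add, Matrix.mul_assoc, Matrix.smul_mul,
    Matrix.mul_smul]
  abel

/-- Antisymmetrizing the law for D_s f_i^k in s and i removes Φ and Ψ by their symmetry; the
antisymmetrized product of two copies of A is det A. -/
lemma JetRelated.ehresmann_eq (h : JetRelated A B α Φ Ψ x x') (hx : x ∈ J1) (hx' : x' ∈ J1)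
    (k : Fin 2) : ∑ l, α k l * ehresmann x l = A.det * ehresmann x' k := by
  have h0 := congrFun (congrFun (h.dfUp_mul hx hx' 0) 1) k
  have h1 := congrFun (congrFun (h.dfUp_mul hx hx' 1) 0) k
  have hΦ := h.symm_Φ 0 1
  have hΨ := h.symm_Ψ 0 1
  simp only [Matrix.mul_apply, Matrix.add_apply, Matrix.transpose_apply, 
    Matrix.smul_apply, smul_eq_mul, Fin.sum_univ_two] at h0 h1
  simp only [KillingJet.ehresmann_eq, Fin.sum_univ_two, Matrix.det_fin_two]
  rw [hΦ 0, hΦ 1, hΨ k] at h0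
  linear_combination h1 - h0

lemma orbitMetric_eq_fUp {c : Coeff} (hc : (hMat c).det ≠ 0) :
    orbitMetric c = bMat c - fUp c * hMat c * (fUp c)ᵀ := by
  rw [fUp_mul_hMat hc, orbitMetric, fUp, transpose_mul, transpose_nonsing_inv, hMat_transpose,
    Matrix.mul_assoc]

/-- In b − f h fᵀ, with f_i^k in place of f, the terms with B produced by b cancel against those of
the gauge law. -/
lemma JetRelated.orbitMetric_eq (h : JetRelated A B α Φ Ψ x x') (hx : x ∈ J1) (hx' : x' ∈ J1) :
    orbitMetric (coeff x) = Aᵀ * orbitMetric (coeff x') * A := by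
  have h1 : fUp (coeff x) * hMat (coeff x) * (fUp (coeff x))ᵀ =
      (fUp (coeff x) * αᵀ) * hMat (coeff x') * (fUp (coeff x) * αᵀ)ᵀ := by
    simp only [h.blocks.1, Matrix.mul_assoc, transpose_mul, transpose_transpose]
  rw [orbitMetric_eq_fUp hx.2, h1, h.fUp_mul hx hx', orbitMetric_eq_fUp hx'.2, h.blocks.2.2,
    ← fUp_mul_hMat hx'.2]
  simp only [Matrix.sub_mul, Matrix.mul_sub, Matrix.add_mul, Matrix.mul_add, Matrix.mul_assoc,
    transpose_mul, transpose_add, transpose_transpose, hMat_transpose]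
  abel

/-! ### Invariance -/

lemma JetRelated.detH_eq (h : JetRelated A B α Φ Ψ x x') : detH x = α.det ^ 2 * detH x' := by
  rw [detH, h.blocks.1, det_mul, det_mul, det_transpose, detH]; ring

lemma JetRelated.detG_eq (h : JetRelated A B α Φ Ψ x x') (hx : x ∈ J1) (hx' : x' ∈ J1) :
    detG x = A.det ^ 2 * detG x' := by
  rw [detG, h.orbitMetric_eq hx hx', det_mul, det_mul, det_transpose, detG]; ring

/-- This polarizes det(αᵀmα) = (det α)² det m. It accounts for the weight of σ and χ, cancelled by
det 𝐡 in their denominators. -/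
lemma polar_congr (m n α : Matrix (Fin 2) (Fin 2) ℝ) :
    polar (αᵀ * m * α) (αᵀ * n * α) = α.det ^ 2 * polar m n := by
  simp only [polar, Matrix.mul_apply, Matrix.transpose_apply, Fin.sum_univ_two, det_fin_two]
  ring

lemma polar_sum_right (m : Matrix (Fin 2) (Fin 2) ℝ) (a : Fin 2 → ℝ)
    (n : Fin 2 → Matrix (Fin 2) (Fin 2) ℝ) :
    polar m (∑ r, a r • n r) = ∑ r, a r * polar m (n r) := by
  simp [polar, Fin.sum_univ_two]; ring

lemma polar_sum_left (m : Matrix (Fin 2) (Fin 2) ℝ) (a : Fin 2 → ℝ)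
    (n : Fin 2 → Matrix (Fin 2) (Fin 2) ℝ) :
    polar (∑ r, a r • n r) m = ∑ r, a r * polar (n r) m := by
  simp [polar, Fin.sum_univ_two]; ring

lemma polar_comm (m n : Matrix (Fin 2) (Fin 2) ℝ) : polar m n = polar n m := by
  simp only [polar]; ring

lemma JetRelated.sigma_eq (h : JetRelated A B α Φ Ψ x x') (i : Fin 2) :
    sigma x i = ∑ r, A r i * sigma x' r := by
  have hα := h.det_α
  simp only [KillingJet.sigma_eq, h.blocks.1, (h.deriv_blocks i).1, polar_congr, polar_sum_right,
    h.detH_eq]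
  rw [mul_div_mul_left _ _ (pow_ne_zero 2 hα), Finset.sum_div]
  simp only [mul_div_assoc]

lemma JetRelated.rho_eq (h : JetRelated A B α Φ Ψ x x') : rho x = Aᵀ * rho x' * A := by
  ext i j
  simp only [rho, Matrix.of_apply, h.sigma_eq, Matrix.mul_apply, Matrix.transpose_apply,
    Fin.sum_univ_two]
  ring

lemma JetRelated.chi_eq (h : JetRelated A B α Φ Ψ x x') : chi x = Aᵀ * chi x' * A := by
  have hα := h.det_α
  ext i j
  rw [KillingJet.chi_eq, (h.deriv_blocks i).1, (h.deriv_blocks j).1, polar_congr, polar_sum_right,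
    h.detH_eq, mul_left_comm, mul_div_mul_left _ _ (pow_ne_zero 2 hα)]
  simp only [polar_sum_left]
  simp only [Matrix.mul_apply,
    KillingJet.chi_eq, Matrix.transpose_apply, Fin.sum_univ_two]
  rw [polar_comm (hMat (x'.2.2 1)) (hMat (x'.2.2 0))]
  ring

lemma JetRelated.gam_eq (h : JetRelated A B α Φ Ψ x x') : gam x = Aᵀ * gam x' * A := by
  simp only [gam, h.chi_eq, h.rho_eq, Matrix.mul_sub, Matrix.sub_mul, Matrix.mul_smul,
    Matrix.smul_mul]

lemma traceInv_eq_trace (μ : Jet → Matrix (Fin 2) (Fin 2) ℝ) (x : Jet) :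
    traceInv μ x = (μ x * (orbitMetric (coeff x))⁻¹).trace := by
  simp [traceInv, Matrix.trace, Matrix.mul_apply, Fin.sum_univ_two, inv_orbitMetric,
    orbitMetric_symm]

lemma JetRelated.traceInv_eq (h : JetRelated A B α Φ Ψ x x') (hx : x ∈ J1) (hx' : x' ∈ J1)
    {μ : Jet → Matrix (Fin 2) (Fin 2) ℝ} (hμ : μ x = Aᵀ * μ x' * A) :
    traceInv μ x = traceInv μ x' := by
  have hA : A * A⁻¹ = 1 := mul_nonsing_inv _ h.det_A.isUnit
  have hA' : (Aᵀ)⁻¹ * Aᵀ = 1 := nonsing_inv_mul _ (by simpa using h.det_A)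
  have h1 : Aᵀ * μ x' * A * (A⁻¹ * (orbitMetric (coeff x'))⁻¹ * (Aᵀ)⁻¹) =
      Aᵀ * (μ x' * (orbitMetric (coeff x'))⁻¹ * (Aᵀ)⁻¹) := by
    simp only [Matrix.mul_assoc]
    rw [← Matrix.mul_assoc A, hA, Matrix.one_mul]
  rw [traceInv_eq_trace, traceInv_eq_trace, hμ, h.orbitMetric_eq hx hx', Matrix.mul_inv_rev, Matrix.mul_inv_rev,
    ← Matrix.mul_assoc A⁻¹, h1, trace_mul_comm, Matrix.mul_assoc, hA', Matrix.mul_one]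

lemma JetRelated.detInv_eq (h : JetRelated A B α Φ Ψ x x') (hx : x ∈ J1) (hx' : x' ∈ J1)
    {μ : Jet → Matrix (Fin 2) (Fin 2) ℝ} (hμ : μ x = Aᵀ * μ x' * A) :
    detInv μ x = detInv μ x' := by
  rw [detInv, detInv, hμ, h.detG_eq hx hx', det_mul, det_mul, det_transpose,
    ← mul_div_mul_left _ (detG x') (pow_ne_zero 2 h.det_A)]
  ring

lemma ellC_eq (x : Jet) : ellC x =
    (∑ k, ∑ l, hMat (coeff x) k l * ehresmann x k * ehresmann x l) / |detG x| := by
  simp only [ellC, curv, Fin.sum_univ_two]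
  rw [← Real.sq_sqrt (abs_nonneg (detG x))]
  simp only [Real.sqrt_sq (Real.sqrt_nonneg _)]
  ring

/-- The determinant in the definition of `Θ_I`, with `c` in place of `𝒞`. -/
def triple (m n : Matrix (Fin 2) (Fin 2) ℝ) (c : Fin 2 → ℝ) : ℝ :=
  Matrix.det !![m 0 0, m 0 1, m 1 1; n 0 0, n 0 1, n 1 1; c 1 ^ 2, -(c 0 * c 1), c 0 ^ 2]

lemma triple_smul (m n : Matrix (Fin 2) (Fin 2) ℝ) (c : Fin 2 → ℝ) (r : ℝ) :
    triple m n (r • c) = r ^ 2 * triple m n c := by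
  simp [triple, det_fin_three]; ring

/-- The last row is quadratic in 𝒞, so it adds a factor |det g̃|⁻¹ to the prefactor |det g̃|^(-1/2);
squaring gives the third power. -/
lemma thetaI_eq (x : Jet) : thetaI x ^ 2 =
    triple (hMat (x.2.2 0)) (hMat (x.2.2 1)) (ehresmann x) ^ 2 / (|detH x| * |detG x| ^ 3) := by
  have h1 : thetaI x = 1 / (Real.sqrt |detH x| * Real.sqrt |detG x|) *
      triple (hMat (x.2.2 0)) (hMat (x.2.2 1)) (curv x) := by
    simp only [thetaI, dh_eq, triple]
  have h2 : curv x = (Real.sqrt |detG x|)⁻¹ • ehresmann x := by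
    ext k; simp only [curv, Pi.smul_apply, smul_eq_mul]; ring
  rw [h1, h2, triple_smul]
  conv_rhs => rw [← Real.sq_sqrt (abs_nonneg (detG x)), ← Real.sq_sqrt (abs_nonneg (detH x))]
  simp only [mul_inv, div_eq_mul_inv]
  ring

/-- The last row is the symmetric matrix (Jc)(Jc)ᵀ with J the rotation by a right angle. For
invertible α, αᵀJα = (det α) J shows that passing from c to αc costs (det α)⁻² there, while
congruence by α acts on the three-dimensional space of symmetric matrices with determinant (det α)³.
-/
lemma triple_congr (m n α : Matrix (Fin 2) (Fin 2) ℝ) (hm : m 1 0 = m 0 1) (hn : n 1 0 = n 0 1)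
    (c : Fin 2 → ℝ) :
    triple (αᵀ * m * α) (αᵀ * n * α) c = α.det * triple m n (α.mulVec c) := by
  simp [triple, det_fin_three, Matrix.mul_apply, Fin.sum_univ_two, det_fin_two, mulVec,
    dotProduct, hm, hn]
  ring

lemma triple_comb (m₀ m₁ A : Matrix (Fin 2) (Fin 2) ℝ) (c : Fin 2 → ℝ) :
    triple (A 0 0 • m₀ + A 1 0 • m₁) (A 0 1 • m₀ + A 1 1 • m₁) c = A.det * triple m₀ m₁ c := by
  simp [triple, det_fin_three, det_fin_two]
  ring

lemma JetRelated.mulVec_ehresmann (h : JetRelated A B α Φ Ψ x x') (hx : x ∈ J1) (hx' : x' ∈ J1) :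
    α.mulVec (ehresmann x) = A.det • ehresmann x' :=
  funext fun k => h.ehresmann_eq hx hx' k

lemma JetRelated.ellC_eq (h : JetRelated A B α Φ Ψ x x') (hx : x ∈ J1) (hx' : x' ∈ J1) :
    ellC x = ellC x' := by
  have h0 := h.ehresmann_eq hx hx' 0
  have h1 := h.ehresmann_eq hx hx' 1
  have h2 : ∑ k, ∑ l, hMat (coeff x) k l * ehresmann x k * ehresmann x l = A.det ^ 2 *
      ∑ k, ∑ l, hMat (coeff x') k l * ehresmann x' k * ehresmann x' l := by
    have h3 : A.det ^ 2 * ∑ k, ∑ l, hMat (coeff x') k l * ehresmann x' k * ehresmann x' l =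
        ∑ k, ∑ l, hMat (coeff x') k l * (A.det * ehresmann x' k) * (A.det * ehresmann x' l) := by
      simp only [Fin.sum_univ_two]; ring
    rw [h3]
    simp only [← h.ehresmann_eq hx hx', h.blocks.1, Fin.sum_univ_two, Matrix.mul_apply,
      Matrix.transpose_apply]
    ring
  rw [KillingJet.ellC_eq, KillingJet.ellC_eq, h2, h.detG_eq hx hx', abs_mul, abs_of_nonneg (sq_nonneg A.det),
    mul_div_mul_left _ _ (pow_ne_zero 2 h.det_A)]

lemma JetRelated.thetaI_eq (h : JetRelated A B α Φ Ψ x x') (hx : x ∈ J1) (hx' : x' ∈ J1) :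
    thetaI x ^ 2 = thetaI x' ^ 2 := by
  have hA := h.det_A
  have hα := h.det_α
  have hs (s : Fin 2) : (∑ r, A r s • hMat (x'.2.2 r)) 1 0 = (∑ r, A r s • hMat (x'.2.2 r)) 0 1 := by
    simp [Fin.sum_univ_two, hMat_symm]
  rw [KillingJet.thetaI_eq, KillingJet.thetaI_eq, (h.deriv_blocks 0).1, (h.deriv_blocks 1).1,
    triple_congr _ _ _ (hs 0) (hs 1), h.mulVec_ehresmann hx hx', triple_smul, Fin.sum_univ_two,
    Fin.sum_univ_two, triple_comb, h.detG_eq hx hx', h.detH_eq, abs_mul, abs_mul,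
    abs_of_nonneg (sq_nonneg A.det), abs_of_nonneg (sq_nonneg α.det)]
  rw [← mul_div_mul_left _ (|detH x'| * |detG x'| ^ 3)
    (mul_ne_zero (pow_ne_zero 2 hα) (pow_ne_zero 6 hA))]
  ring

lemma isInvariant_invariants (i : Fin 6) : IsInvariant J1 (invariants i) := by
  refine ⟨fun x hx => (contDiffAt_invariants (n := ⊤) hx i).contDiffWithinAt, ?_⟩
  intro P W s s' hP hT p hp hx hx'
  obtain ⟨A, B, α, Φ, Ψ, -, -, h⟩ := exists_jetRelated hP hT hp
  symm
  fin_cases i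
  · exact h.traceInv_eq hx hx' h.rho_eq
  · exact h.traceInv_eq hx hx' h.chi_eq
  · exact h.detInv_eq hx hx' h.chi_eq
  · exact h.detInv_eq hx hx' h.gam_eq
  · exact h.ellC_eq hx hx'
  · exact h.thetaI_eq hx hx'

end

/-! ### Local elements of the pseudogroup -/

lemma jacobian_eq_toMatrix' (P : M → M) (p : M) :
    jacobian P p = LinearMap.toMatrix' (fderiv ℝ P p : M →ₗ[ℝ] M) := by
  ext a c
  simp [jacobian, LinearMap.toMatrix'_apply]

/-- The inverse function theorem supplies a neighbourhood on which P is injective; it is shrunk to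
keep the Jacobian determinant nonzero. -/
lemma exists_isAdaptedTransformation {P : M → M} {p : M} (hP : ContDiff ℝ ∞ P)
    (hdet : (jacobian P p).det ≠ 0) {α : Matrix (Fin 2) (Fin 2) ℝ} (hα : α.det ≠ 0)
    (h : ∀ q j, fderiv ℝ P q (dz j) = ∑ i, α i j • dz i) :
    ∃ W, p ∈ W ∧ IsAdaptedTransformation P W := by
  have hd : (fderiv ℝ P p).det ≠ 0 := by
    rw [jacobian_eq_toMatrix', LinearMap.det_toMatrix'] at hdet
    exact hdet
  let f' := (fderiv ℝ P p).toContinuousLinearEquivOfDetNeZero hd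
  have hf' : HasFDerivAt P (f' : M →L[ℝ] M) p := by
    rw [ContinuousLinearMap.coe_toContinuousLinearEquivOfDetNeZero]
    exact (hP.differentiable (by simp) p).hasFDerivAt
  let e := hP.contDiffAt.toOpenPartialHomeomorph P hf' (by simp)
  have hcont : Continuous fun q => (jacobian P q).det := by
    refine Continuous.matrix_det (continuous_matrix fun a c => ?_)
    exact (continuous_apply a).comp ((hP.continuous_fderiv (by simp)).clm_apply continuous_const)
  refine ⟨e.source ∩ {q | (jacobian P q).det ≠ 0},
    ⟨hP.contDiffAt.mem_toOpenPartialHomeomorph_source hf' (by simp), hdet⟩,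
    e.open_source.inter (isOpen_ne_fun hcont continuous_const), hP.contDiffOn, ?_,
    fun q hq => hq.2, α, hα, fun q _ j => h q j⟩
  exact e.injOn.mono Set.inter_subset_left

/-! ### Coefficients from symmetric matrices -/

/-- The coefficients of a symmetric matrix. -/
def ofMat (m : Matrix (Fin 2 ⊕ Fin 2) (Fin 2 ⊕ Fin 2) ℝ) : Coeff :=
  (Sym2.lift ⟨fun i j => (m (Sum.inl i) (Sum.inl j) + m (Sum.inl j) (Sum.inl i)) / 2,
      fun _ _ => congrArg (· / 2) (add_comm _ _)⟩,
    fun i k => m (Sum.inl i) (Sum.inr k),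
    Sym2.lift ⟨fun i j => (m (Sum.inr i) (Sum.inr j) + m (Sum.inr j) (Sum.inr i)) / 2,
      fun _ _ => congrArg (· / 2) (add_comm _ _)⟩)

lemma metric_ofMat {m : Matrix (Fin 2 ⊕ Fin 2) (Fin 2 ⊕ Fin 2) ℝ} (hm : mᵀ = m) :
    metric (ofMat m) = m := by
  have h (a b) : m a b = m b a := congrFun (congrFun hm b) a
  ext (a | a) (b | b)
  · simp [metric, ofMat, bMat, h (Sum.inl b)]
  · simp [metric, ofMat, fMat]
  · simp [metric, ofMat, fMat, h (Sum.inl b)]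
  · simp [metric, ofMat, hMat, h (Sum.inr b)]

lemma metric_transpose (c : Coeff) : (metric c)ᵀ = metric c := by
  rw [metric, fromBlocks_transpose, bMat_transpose, hMat_transpose, transpose_transpose]

lemma metric_injective : Function.Injective metric := by
  intro c c' h
  obtain ⟨hb, hf, -, hh⟩ := fromBlocks_inj.mp h
  refine Prod.ext ?_ (Prod.ext ?_ ?_)
  · ext z
    induction z with
    | _ i j => exact congrFun (congrFun hb i) j
  · exact hf
  · ext z
    induction z with
    | _ i j => exact congrFun (congrFun hh i) j

lemma metric_add (c c' : Coeff) : metric (c + c') = metric c + metric c' := by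
  ext a b; exact map_add (metricEntry a b) c c'

lemma metric_smul (r : ℝ) (c : Coeff) : metric (r • c) = r • metric c := by
  ext a b; exact map_smul (metricEntry a b) r c

lemma metric_zero : metric 0 = 0 := by
  ext a b; exact map_zero (metricEntry a b)

lemma contDiff_ofMat {E : Type*} [NormedAddCommGroup E] [NormedSpace ℝ E] {n : WithTop ℕ∞}
    {m : E → Matrix (Fin 2 ⊕ Fin 2) (Fin 2 ⊕ Fin 2) ℝ}
    (hm : ∀ a b, ContDiff ℝ n fun t => m t a b) : ContDiff ℝ n fun t => ofMat (m t) := by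
  refine ContDiff.prodMk ?_ (ContDiff.prodMk ?_ ?_)
  · refine contDiff_pi.mpr fun z => ?_
    induction z with
    | _ i j => exact ((hm _ _).add (hm _ _)).div_const 2
  · exact contDiff_pi.mpr fun i => contDiff_pi.mpr fun k => hm _ _
  · refine contDiff_pi.mpr fun z => ?_
    induction z with
    | _ i j => exact ((hm _ _).add (hm _ _)).div_const 2

/-! ### Quadratic transformations -/

/-- The data of the second-order jet of a one-parameter family of adapted transformations. -/
structure Generator where
  /-- The velocity of the base point. -/
  v : M
  /-- The blocks of the velocity of the Jacobian matrix. -/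
  (a β κ : Matrix (Fin 2) (Fin 2) ℝ)
  /-- The blocks of the velocity of the second derivatives. -/
  (Φ Ψ : Fin 2 → Matrix (Fin 2) (Fin 2) ℝ)
  symm_Φ : ∀ i j k, Φ i k j = Φ j k i
  symm_Ψ : ∀ i j k, Ψ i k j = Ψ j k i

namespace Generator

variable (g : Generator) (p : M) (ε : ℝ)

/-- The velocity of the Jacobian matrix. -/
def X : Matrix (Fin 2 ⊕ Fin 2) (Fin 2 ⊕ Fin 2) ℝ := fromBlocks g.a 0 g.β g.κ

/-- The velocity of the derivative of the Jacobian matrix. -/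
def Y (s : Fin 2) : Matrix (Fin 2 ⊕ Fin 2) (Fin 2 ⊕ Fin 2) ℝ := fromBlocks (g.Φ s) 0 (g.Ψ s) 0

lemma symm_Y (i j : Fin 2) (k : Fin 2 ⊕ Fin 2) : g.Y i k (Sum.inl j) = g.Y j k (Sum.inl i) := by
  rcases k with k | k
  · exact g.symm_Φ i j k
  · exact g.symm_Ψ i j k

/-- The quadratic transformation with the given second-order jet at `p`. -/
def map : M → M := fun q k => q k + ε * (g.v k + ∑ c, g.X k c * (q c - p c) +
  ∑ i, ∑ j, g.Y i k (Sum.inl j) * (q (Sum.inl i) - p (Sum.inl i)) *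
    (q (Sum.inl j) - p (Sum.inl j)) / 2)

lemma contDiff_map : ContDiff ℝ ∞ (g.map p ε) := by
  unfold map
  refine contDiff_pi.mpr fun k => ?_
  fun_prop

lemma map_self : g.map p ε p = p + ε • g.v := by
  ext k; simp [map]

lemma jacobian_map (q : M) : jacobian (g.map p ε) q =
    1 + ε • (g.X + ∑ i, (q (Sum.inl i) - p (Sum.inl i)) • g.Y i) := by
  ext k c
  have hl (d) : HasDerivAt (fun t : ℝ => (q + t • (Pi.single c 1 : M)) d)
      ((Pi.single c 1 : M) d) 0 := hasDerivAt_pi.mp (hasDerivAt_line q (Pi.single c 1)) d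
  have h1 : HasDerivAt (fun t : ℝ => g.map p ε (q + t • (Pi.single c 1 : M)) k) _ 0 :=
    (hl k).add (((HasDerivAt.fun_sum fun d (_ : d ∈ Finset.univ) =>
        (((hl d).sub_const (p d)).const_mul (g.X k d))).const_add (g.v k) |>.add
      (HasDerivAt.fun_sum fun i (_ : i ∈ Finset.univ) =>
        HasDerivAt.fun_sum fun j (_ : j ∈ Finset.univ) =>
        ((((hl (Sum.inl i)).sub_const (p (Sum.inl i))).const_mul (g.Y i k (Sum.inl j))).mul
          ((hl (Sum.inl j)).sub_const (p (Sum.inl j)))).div_const 2)).const_mul ε)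
  have h0 : HasFDerivAt (g.map p ε) (fderiv ℝ (g.map p ε) q)
      (q + (0 : ℝ) • (Pi.single c 1 : M)) := by
    simpa using ((g.contDiff_map p ε).differentiable (by simp) q).hasFDerivAt
  have h2 := hasDerivAt_pi.mp (h0.comp_hasDerivAt (0 : ℝ) (hasDerivAt_line q (Pi.single c 1))) k
  have h3 := h2.unique h1
  -- Differentiating the quadratic term yields two halves, which this symmetry merges into one.
  have h4 := g.symm_Y 0 1 k
  rw [jacobian, Matrix.of_apply, h3]
  rcases c with c | c
  · fin_cases c <;>
    · simp [Matrix.one_apply, Pi.single_apply, Fin.sum_univ_two, h4]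
      ring
  · simp [Matrix.one_apply, Pi.single_apply, Fin.sum_univ_two, Y]
    rcases k with k | k <;> simp

lemma jacobian_map_self : jacobian (g.map p ε) p = 1 + ε • g.X := by
  simp [jacobian_map]

lemma hessian_map_self (s : Fin 2) : hessian (g.map p ε) p s = ε • g.Y s := by
  ext k c
  refine (hasDerivAt_jacobian (g.contDiff_map p ε).contDiffAt s k c).unique ?_
  have h : (fun t : ℝ => jacobian (g.map p ε) (p + t • Pi.single (Sum.inl s) 1) k c) =
      fun t : ℝ => (1 + ε • g.X : Matrix _ _ ℝ) k c + t * (ε • g.Y s : Matrix _ _ ℝ) k c := by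
    ext t
    rw [jacobian_map]
    simp [Pi.single_apply]
    ring
  rw [h]
  simpa only [one_mul] using
    ((hasDerivAt_id' (0 : ℝ)).mul_const ((ε • g.Y s : Matrix _ _ ℝ) k c)).const_add
      ((1 + ε • g.X : Matrix _ _ ℝ) k c)

lemma fderiv_map_dz (q : M) (j : Fin 2) :
    fderiv ℝ (g.map p ε) q (dz j) = ∑ i, (1 + ε • g.κ) i j • dz i := by
  ext k
  change jacobian (g.map p ε) q k (Sum.inr j) = _
  rw [jacobian_map]
  rcases k with k | k
  · simp [X, Y, dz, Fin.sum_univ_two]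
  · simp [X, Y, dz, Fin.sum_univ_two, Pi.single_apply, Matrix.one_apply]

end Generator

/-! ### The prolonged action along a family of quadratic transformations -/

namespace Generator

variable (g : Generator) (x : Jet) (ε : ℝ)

/-- The affine section through a given jet, translated. -/
def target : (Fin 2 → ℝ) → Coeff := fun t =>
  coeff x + ∑ r, (t r - tCoord (x.1 + ε • g.v) r) • x.2.2 r

lemma contDiff_target : ContDiff ℝ ∞ (g.target x ε) := by
  unfold target
  fun_prop

lemma jetOf_target : jetOf (g.target x ε) (x.1 + ε • g.v) = (x.1 + ε • g.v, coeff x, x.2.2) := by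
  have h : HasFDerivAt (g.target x ε) (∑ r, (ContinuousLinearMap.proj (R := ℝ) r).smulRight (x.2.2 r))
      (tCoord (x.1 + ε • g.v)) :=
    (HasFDerivAt.fun_sum fun r _ => (((ContinuousLinearMap.proj (R := ℝ) (φ := fun _ : Fin 2 => ℝ)
      r).hasFDerivAt.sub_const _).smul_const (x.2.2 r))).const_add (coeff x)
  refine Prod.ext rfl (Prod.ext ?_ ?_)
  · simp [jetOf, target]
  · funext i
    simp only [jetOf, h.fderiv]
    fin_cases i <;> simp

/-- The point with orbit coordinates `t` in the section through `x`. -/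
def lift (t : Fin 2 → ℝ) : M := Sum.elim t fun k => x.1 (Sum.inr k)

/-- The pull-back of the section `target` along the transformation `map`. -/
def source : (Fin 2 → ℝ) → Coeff := fun t =>
  ofMat ((jacobian (g.map x.1 ε) (lift x t))ᵀ *
    metric (g.target x ε (tCoord (g.map x.1 ε (lift x t)))) * jacobian (g.map x.1 ε) (lift x t))

lemma contDiff_lift : ContDiff ℝ ∞ (lift x) := by
  refine contDiff_pi.mpr fun k => ?_
  rcases k with k | k <;> simp only [lift, Sum.elim_inl, Sum.elim_inr] <;> fun_prop

lemma contDiff_source : ContDiff ℝ ∞ (g.source x ε) := by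
  refine contDiff_ofMat fun a b => ?_
  have hJ (a b) : ContDiff ℝ ∞ fun t => jacobian (g.map x.1 ε) (lift x t) a b := by
    simp only [jacobian_map, Matrix.add_apply, Matrix.smul_apply, Matrix.sum_apply, smul_eq_mul]
    have h := contDiff_pi.mp (contDiff_lift x)
    fun_prop
  have hm (a b) : ContDiff ℝ ∞ fun t =>
      metric (g.target x ε (tCoord (g.map x.1 ε (lift x t)))) a b := by
    refine (metricEntry a b).contDiff.comp ((g.contDiff_target x ε).comp ?_)
    exact contDiff_pi.mpr fun i =>
      contDiff_pi.mp ((g.contDiff_map x.1 ε).comp (contDiff_lift x)) (Sum.inl i)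
  simp only [Matrix.mul_apply, Matrix.transpose_apply]
  fun_prop

/-- The Jacobian matrix and the t-components of the image depend on t alone, so freezing z in
`source` loses nothing. -/
lemma transforms {W : Set M} : Transforms (g.map x.1 ε) W (g.source x ε) (g.target x ε) := by
  refine ⟨fun p _ => (g.contDiff_source x ε).contDiffAt,
    fun p _ => (g.contDiff_target x ε).contDiffAt, fun p _ => ?_⟩
  have h1 : jacobian (g.map x.1 ε) (lift x (tCoord p)) = jacobian (g.map x.1 ε) p := by
    simp [jacobian_map, lift, tCoord]
  have h2 : tCoord (g.map x.1 ε (lift x (tCoord p))) = tCoord (g.map x.1 ε p) := by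
    ext i
    simp [tCoord, map, lift, X]
  rw [source, metric_ofMat, h1, h2]
  simp only [transpose_mul, transpose_transpose, metric_transpose, Matrix.mul_assoc]

/-- The velocity of the fibre part of the prolonged action. -/
def tangent : Jet :=
  (0, ofMat (g.Xᵀ * metric (coeff x) + metric (coeff x) * g.X), fun s =>
    ofMat ((g.Y s)ᵀ * metric (coeff x) + metric (coeff x) * g.Y s +
      (g.Xᵀ * metric (x.2.2 s) + metric (x.2.2 s) * g.X) + ∑ r, g.a r s • metric (x.2.2 r)))

/-- The second-order part of the prolonged action. -/
def tangent₂ : Jet :=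
  (0, ofMat (g.Xᵀ * metric (coeff x) * g.X), fun s =>
    ofMat ((g.Y s)ᵀ * metric (coeff x) * g.X + g.Xᵀ * metric (coeff x) * g.Y s +
      g.Xᵀ * metric (x.2.2 s) * g.X + (g.Xᵀ * (∑ r, g.a r s • metric (x.2.2 r)) +
      (∑ r, g.a r s • metric (x.2.2 r)) * g.X)))

/-- The third-order part of the prolonged action. -/
def tangent₃ : Jet :=
  (0, 0, fun s => ofMat (g.Xᵀ * (∑ r, g.a r s • metric (x.2.2 r)) * g.X))

/-- The transformed jet is exactly polynomial in ε: the pull-back by 1 + εX is quadratic, and the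
factor A = 1 + εa from the chain rule raises the degree to three for derivatives. Only the linear
term `tangent` matters afterwards. -/
lemma jetOf_source {W : Set M} (hP : IsAdaptedTransformation (g.map x.1 ε) W) (hx : x.1 ∈ W) :
    jetOf (g.source x ε) x.1 =
      x + (ε • g.tangent x + ε ^ 2 • g.tangent₂ x + ε ^ 3 • g.tangent₃ x) := by
  obtain ⟨A, B, α, Φ, Ψ, hJ, hH, h⟩ := exists_jetRelated hP (g.transforms x ε) hx
  have hJ1 : fromBlocks A 0 B α = 1 + ε • g.X := by rw [← hJ, jacobian_map_self]
  have hA (r s : Fin 2) : A r s = (1 : Matrix (Fin 2) (Fin 2) ℝ) r s + ε * g.a r s := by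
    have := congrFun (congrFun hJ1 (Sum.inl r)) (Sum.inl s)
    simpa [X, Matrix.one_apply] using this
  have h1 := h.metric_eq
  have h2 := h.deriv_eq
  simp only [hJ1, ← hH, hessian_map_self, map_self, jetOf_target] at h1 h2
  have hN (s : Fin 2) : (∑ r, A r s • metric (x.2.2 r)) =
      metric (x.2.2 s) + ε • ∑ r, g.a r s • metric (x.2.2 r) := by
    simp only [hA, Fin.sum_univ_two]
    revert s
    refine Fin.forall_fin_two.mpr ⟨?_, ?_⟩ <;> simp <;> module
  simp only [hN] at h2
  have hNt (s : Fin 2) : (∑ r, g.a r s • metric (x.2.2 r))ᵀ = ∑ r, g.a r s • metric (x.2.2 r) := by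
    simp [transpose_smul, metric_transpose]
  refine Prod.ext ?_ (Prod.ext ?_ (funext fun s => ?_))
  · simp [tangent, tangent₂, tangent₃, jetOf]
  · apply metric_injective
    refine h1.trans ?_
    simp only [tangent, tangent₂, tangent₃, Prod.snd_add, Prod.fst_add, Prod.smul_fst, Prod.smul_snd,
      metric_add, metric_smul, metric_zero]
    rw [metric_ofMat, metric_ofMat]
    · change _ = metric (coeff x) + _
      simp only [coeff, transpose_add, transpose_one, transpose_smul, Matrix.add_mul,
        Matrix.mul_add, Matrix.one_mul, Matrix.mul_one, Matrix.smul_mul, Matrix.mul_smul, smul_add]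
      module
    · simp only [transpose_mul, transpose_transpose, metric_transpose, Matrix.mul_assoc]
    · simp only [transpose_add, transpose_mul, transpose_transpose, metric_transpose]
      abel
  · apply metric_injective
    refine (h2 s).trans ?_
    simp only [tangent, tangent₂, tangent₃, Prod.snd_add, Prod.smul_snd, Pi.add_apply, Pi.smul_apply,
      metric_add, metric_smul]
    rw [metric_ofMat, metric_ofMat, metric_ofMat]
    · generalize (∑ r, g.a r s • metric (x.2.2 r)) = N
      simp only [coeff, transpose_add, transpose_one, transpose_smul, Matrix.add_mul,
        Matrix.mul_add, Matrix.one_mul, Matrix.mul_one, Matrix.smul_mul, Matrix.mul_smul, smul_add]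
      module
    · simp only [transpose_mul, transpose_transpose, hNt, Matrix.mul_assoc]
    · simp only [transpose_add, transpose_mul, transpose_transpose, metric_transpose, hNt,
        Matrix.mul_assoc]
      abel
    · simp only [transpose_add, transpose_mul, transpose_transpose, metric_transpose, hNt]
      abel

variable {x}

lemma eventually_isAdaptedTransformation :
    ∀ᶠ ε : ℝ in nhds 0, ∃ W, x.1 ∈ W ∧ IsAdaptedTransformation (g.map x.1 ε) W := by
  have h1 : Continuous fun ε : ℝ => (1 + ε • g.X).det := by fun_prop
  have h2 : Continuous fun ε : ℝ => (1 + ε • g.κ).det := by fun_prop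
  have e1 := h1.continuousAt.eventually_ne (x := 0) (y := 0) (by simp)
  have e2 := h2.continuousAt.eventually_ne (x := 0) (y := 0) (by simp)
  filter_upwards [e1, e2] with ε h1 h2
  exact exists_isAdaptedTransformation (g.contDiff_map x.1 ε)
    (by rwa [jacobian_map_self]) h2 (g.fderiv_map_dz x.1 ε)

end Generator

/-- The differential of an invariant vanishes on the orbits of the pseudogroup. -/
lemma IsInvariant.fderiv_tangent {U : Set Jet} {F : Jet → ℝ} (hF : IsInvariant U F) (hU : IsOpen U)
    {x : Jet} (hx : x ∈ U) (g : Generator) :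
    fderiv ℝ F x (g.v, 0, 0) = fderiv ℝ F x (g.tangent x) := by
  have hd : HasFDerivAt F (fderiv ℝ F x) x :=
    (((hF.smooth x hx).contDiffAt (hU.mem_nhds hx)).differentiableAt (by simp)).hasFDerivAt
  -- Two curves of jets starting at x are compared: in the target only the base point moves, in the
  -- source only the fibre coordinates do.
  have hc1 : HasDerivAt (fun ε : ℝ => x + ε • ((g.v, 0, 0) : Jet)) (g.v, 0, 0) 0 := by
    simpa using ((hasDerivAt_id' (0 : ℝ)).smul_const ((g.v, 0, 0) : Jet)).const_add x
  have hc2 : HasDerivAt (fun ε : ℝ =>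
      x + (ε • g.tangent x + ε ^ 2 • g.tangent₂ x + ε ^ 3 • g.tangent₃ x)) (g.tangent x) 0 := by
    have h1 := (hasDerivAt_id' (0 : ℝ)).smul_const (g.tangent x)
    have h2 := (hasDerivAt_pow 2 (0 : ℝ)).smul_const (g.tangent₂ x)
    have h3 := (hasDerivAt_pow 3 (0 : ℝ)).smul_const (g.tangent₃ x)
    simpa using ((h1.add h2).add h3).const_add x
  have m1 : ∀ᶠ ε : ℝ in nhds 0, x + ε • ((g.v, 0, 0) : Jet) ∈ U :=
    hc1.continuousAt.eventually_mem (hU.mem_nhds (by simpa using hx))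
  have m2 : ∀ᶠ ε : ℝ in nhds 0,
      x + (ε • g.tangent x + ε ^ 2 • g.tangent₂ x + ε ^ 3 • g.tangent₃ x) ∈ U :=
    hc2.continuousAt.eventually_mem (hU.mem_nhds (by simpa using hx))
  have d1 := HasFDerivAt.comp_hasDerivAt (0 : ℝ) (l' := fderiv ℝ F x) (l := F)
    (by simpa using hd) hc1
  have d2 := HasFDerivAt.comp_hasDerivAt (0 : ℝ) (l' := fderiv ℝ F x) (l := F)
    (by simpa using hd) hc2
  refine d1.unique (d2.congr_of_eventuallyEq ?_)
  filter_upwards [m1, m2, g.eventually_isAdaptedTransformation (x := x)] with ε h1 h2 ⟨W, hxW, hP⟩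
  have h3 := g.jetOf_source x ε hP hxW
  have h4 : jetOf (g.target x ε) (g.map x.1 ε x.1) = x + ε • ((g.v, 0, 0) : Jet) := by
    rw [Generator.map_self, Generator.jetOf_target]
    refine Prod.ext rfl (Prod.ext ?_ ?_) <;> simp [coeff]
  -- The two curves are related by the pseudogroup for each small ε, so F agrees along them.
  have := hF.invariant _ W _ _ hP (g.transforms x ε) x.1 hxW (by rwa [h3]) (by rwa [h4])
  rw [h3, h4] at this
  exact this

/-! ### Linear forms vanishing along the orbits -/

lemma linearMap_apply (L : Matrix (Fin 2) (Fin 2) ℝ →ₗ[ℝ] ℝ) (m : Matrix (Fin 2) (Fin 2) ℝ) :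
    L m = ∑ i, ∑ j, m i j * L (Matrix.single i j 1) := by
  conv_lhs => rw [Matrix.matrix_eq_sum_single m]
  simp only [map_sum]
  refine Finset.sum_congr rfl fun i _ => Finset.sum_congr rfl fun j _ => ?_
  rw [← smul_eq_mul, ← map_smul, Matrix.smul_single, smul_eq_mul, mul_one]

lemma linearMap_eq_zero_of_single {L : Matrix (Fin 2) (Fin 2) ℝ →ₗ[ℝ] ℝ}
    (h : ∀ i j, L (Matrix.single i j 1) = 0) : L = 0 := by
  refine LinearMap.ext fun m => ?_
  rw [linearMap_apply]
  simp [h]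

/-- The determinant of three symmetric matrices, as vectors of a three-dimensional space. -/
def tri (m n k : Matrix (Fin 2) (Fin 2) ℝ) : ℝ :=
  m 0 0 * (n 0 1 * k 1 1 - n 1 1 * k 0 1) - m 0 1 * (n 0 0 * k 1 1 - n 1 1 * k 0 0) +
    m 1 1 * (n 0 0 * k 0 1 - n 0 1 * k 0 0)

/-- Cramer's rule in the three-dimensional space of symmetric 2 × 2 matrices. -/
lemma tri_cramer {m n k r : Matrix (Fin 2) (Fin 2) ℝ} (hm : m 1 0 = m 0 1) (hn : n 1 0 = n 0 1)
    (hk : k 1 0 = k 0 1) (hr : r 1 0 = r 0 1) :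
    tri m n k • r = tri r n k • m + tri m r k • n + tri m n r • k := by
  ext i j
  fin_cases i <;> fin_cases j <;> simp [tri, hm, hn, hk, hr] <;> ring

/-- The bivector `h ∧ k`, realized as the symmetric matrix orthogonal to `h` and `k`. -/
def wedge (h k : Matrix (Fin 2) (Fin 2) ℝ) : Matrix (Fin 2) (Fin 2) ℝ :=
  !![2 * (k 0 0 * h 0 1 - k 0 1 * h 0 0), k 0 0 * h 1 1 - k 1 1 * h 0 0;
    k 0 0 * h 1 1 - k 1 1 * h 0 0, 2 * (k 0 1 * h 1 1 - k 1 1 * h 0 1)]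

section Forms

variable {Lb Lf Lh : Matrix (Fin 2) (Fin 2) ℝ →ₗ[ℝ] ℝ}
  {Nb Nf Nh : Fin 2 → Matrix (Fin 2) (Fin 2) ℝ →ₗ[ℝ] ℝ}
  {b f h g : Matrix (Fin 2) (Fin 2) ℝ} {k : Fin 2 → Matrix (Fin 2) (Fin 2) ℝ}

/-- As with the Levi-Civita connection, the second derivatives of t̄ can produce any prescribed
symmetric variations of b_{ij,s}, while those of z̄ are chosen to leave f_{ik,s} unaffected. -/
lemma Nb_eq_zero (hNb : ∀ s m, Nb s mᵀ = Nb s m) (hd : h.det ≠ 0)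
    (hg : g = b - f * h⁻¹ * fᵀ) (hgd : g.det ≠ 0)
    (H : ∀ Φ Ψ : Fin 2 → Matrix (Fin 2) (Fin 2) ℝ, (∀ i j k, Φ i k j = Φ j k i) →
      (∀ i j k, Ψ i k j = Ψ j k i) →
      ∑ s, (Nb s ((b * Φ s + f * Ψ s)ᵀ + (b * Φ s + f * Ψ s)) +
        Nf s ((fᵀ * Φ s + h * Ψ s)ᵀ)) = 0) (s : Fin 2) : Nb s = 0 := by
  have key (m : Fin 2 → Matrix (Fin 2) (Fin 2) ℝ) (hm : ∀ s, (m s)ᵀ = m s) :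
      ∑ s, Nb s (m s) = 0 := by
    have hm' (s i j) : m s i j = m s j i := congrFun (congrFun (hm s) j) i
    -- Christoffel symbols of the first kind of the prescribed derivatives m, with the first index
    -- lowered.
    let Γ : Fin 2 → Matrix (Fin 2) (Fin 2) ℝ := fun s =>
      Matrix.of fun j i => (m s i j + m i j s - m j i s) / 2
    have hΓ (i j k) : Γ i k j = Γ j k i := by
      simp only [Γ, Matrix.of_apply]; rw [hm' k j i]; ring_nf; rw [hm' i j k, hm' j i k]; ring
    let Φ : Fin 2 → Matrix (Fin 2) (Fin 2) ℝ := fun s => g⁻¹ * Γ s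
    have hΦ (i j k) : Φ i k j = Φ j k i := by
      simp only [Φ, Matrix.mul_apply]
      exact Finset.sum_congr rfl fun l _ => by rw [hΓ]
    -- This choice annihilates the f-part and replaces b by its Schur complement g in the b-part.
    let Ψ : Fin 2 → Matrix (Fin 2) (Fin 2) ℝ := fun s => -(h⁻¹ * fᵀ * Φ s)
    have hΨ (i j k) : Ψ i k j = Ψ j k i := by
      simp only [Ψ, Matrix.neg_apply, Matrix.mul_apply]
      congr 1
      exact Finset.sum_congr rfl fun l _ => by rw [hΦ]
    have h1 := H Φ Ψ hΦ hΨ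
    have h2 (s) : fᵀ * Φ s + h * Ψ s = 0 := by
      simp only [Ψ, Matrix.mul_neg, ← Matrix.mul_assoc, mul_nonsing_inv _ hd.isUnit, Matrix.one_mul,
        add_neg_cancel]
    have h3 (s) : b * Φ s + f * Ψ s = Γ s := by
      have : b * Φ s + f * Ψ s = g * Φ s := by
        rw [hg, Matrix.sub_mul]
        simp only [Ψ, Matrix.mul_neg, Matrix.mul_assoc, sub_eq_add_neg]
      rw [this, ← Matrix.mul_assoc, mul_nonsing_inv _ hgd.isUnit, Matrix.one_mul]
    have h4 (s) : (Γ s)ᵀ + Γ s = m s := by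
      ext i j
      simp only [Γ, Matrix.add_apply, Matrix.transpose_apply, Matrix.of_apply]
      rw [hm' s j i, hm' i j s, hm' j i s]; ring
    simpa only [h2, h3, h4, transpose_zero, map_zero, add_zero] using h1
  refine LinearMap.ext fun m => ?_
  -- Only symmetric matrices are reached; invariance under transposition turns the value at m + mᵀ
  -- into twice the value at m.
  have h1 := key (Pi.single s (m + mᵀ)) (fun r => by
    rcases eq_or_ne r s with rfl | hr
    · simp [add_comm]
    · simp [hr])
  rw [Finset.sum_eq_single s (fun r _ hr => by simp [hr]) (by simp), Pi.single_eq_same, map_add,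
    hNb] at h1
  simp only [LinearMap.zero_apply]
  linarith

/-- The second derivatives of z̄ reach every variation of f_{ik,s} symmetric in i and s. The
antisymmetric part, which is the curvature, is out of their reach and is handled by the two
directions in `V`. -/
lemma Nf_eq_zero (hd : h.det ≠ 0)
    (H : ∀ Ψ : Fin 2 → Matrix (Fin 2) (Fin 2) ℝ, (∀ i j k, Ψ i k j = Ψ j k i) →
      ∑ s, Nf s ((Ψ s)ᵀ * h) = 0)
    (V : ∀ k, Nf 1 (Matrix.single 0 k 1 * h) = 0) (s : Fin 2) : Nf s = 0 := by
  have h0 (k) : Nf 0 (Matrix.single 0 k 1 * h) = 0 := by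
    have := H ![Matrix.single k 0 1, 0] (by
      intro i j l
      fin_cases i <;> fin_cases j <;> simp [Matrix.single_apply])
    simpa using this
  have h1 (k) : Nf 1 (Matrix.single 1 k 1 * h) = 0 := by
    have := H ![0, Matrix.single k 1 1] (by
      intro i j l
      fin_cases i <;> fin_cases j <;> simp [Matrix.single_apply])
    simpa using this
  have h2 (k) : Nf 0 (Matrix.single 1 k 1 * h) = 0 := by
    have := H ![Matrix.single k 1 1, Matrix.single k 0 1] (by
      intro i j l
      fin_cases i <;> fin_cases j <;> simp [Matrix.single_apply])
    simpa [V] using this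
  have h3 : (Nf s).comp (LinearMap.mulRight ℝ h) = 0 := by
    refine linearMap_eq_zero_of_single fun i j => ?_
    simp only [LinearMap.comp_apply, LinearMap.mulRight_apply]
    fin_cases s <;> fin_cases i
    exacts [h0 j, h2 j, V j, h1 j]
  refine LinearMap.ext fun m => ?_
  have h4 := LinearMap.congr_fun h3 (m * h⁻¹)
  rw [LinearMap.zero_apply] at h4 ⊢
  simpa only [LinearMap.comp_apply, LinearMap.mulRight_apply, Matrix.mul_assoc,
    nonsing_inv_mul _ hd.isUnit, Matrix.mul_one] using h4

/-- The hypothesis on `tri` makes h, k 0, k 1 a basis of the symmetric matrices. -/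
lemma Nh_zero_eq_zero (hNh : ∀ m, Nh 0 mᵀ = Nh 0 m) (hh : hᵀ = h) (hk : ∀ s, (k s)ᵀ = k s)
    (hT : tri h (k 0) (k 1) ≠ 0) (V1 : Nh 0 h = 0) (V2 : Nh 0 (k 0) = 0) (V3 : Nh 0 (k 1) = 0) :
    Nh 0 = 0 := by
  have key (r : Matrix (Fin 2) (Fin 2) ℝ) (hr : r 1 0 = r 0 1) : Nh 0 r = 0 := by
    have h1 := congrArg (Nh 0) (tri_cramer (congrFun (congrFun hh 0) 1)
      (congrFun (congrFun (hk 0) 0) 1) (congrFun (congrFun (hk 1) 0) 1) hr)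
    simp only [map_add, map_smul, V1, V2, V3, smul_zero, add_zero] at h1
    exact (smul_eq_zero.mp h1).resolve_left hT
  refine LinearMap.ext fun m => ?_
  have h1 := key (m + mᵀ) (by simp [add_comm])
  rw [map_add, hNh] at h1
  simp only [LinearMap.zero_apply]
  linarith

/-- There remain 3 + 4 + 3 unknowns in `Lb`, `Lf`, `Lh` and two in `Nh 1`, matching the twelve
parameters a, β, κ. Eliminating β leaves a system in which everything reduces to the single
component `l11`, whose coefficient is the expression in `hE`. -/
lemma forms_eq_zero (hLb : ∀ m, Lb mᵀ = Lb m) (hLh : ∀ m, Lh mᵀ = Lh m)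
    (hN : ∀ m, Nh 1 mᵀ = Nh 1 m) (hd : h.det ≠ 0) (hh : hᵀ = h) (hk : ∀ s, (k s)ᵀ = k s)
    (hg : g = b - f * h⁻¹ * fᵀ) (hgd : g.det ≠ 0) (hgs : g 1 0 = g 0 1)
    (H : ∀ a β κ : Matrix (Fin 2) (Fin 2) ℝ, Lb ((b * a + f * β)ᵀ + (b * a + f * β)) +
      Lf ((fᵀ * a + h * β)ᵀ + f * κ) + Lh ((h * κ)ᵀ + h * κ) +
      Nh 1 ((k 1 * κ)ᵀ + k 1 * κ + ∑ r, a r 1 • k r) = 0)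
    (V : Nh 1 h = 0) (hT : tri h (k 0) (k 1) ≠ 0)
    (hE : g 0 1 * tri h (wedge h (k 1)) (k 1) + g 1 1 * tri h (k 0) (wedge h (k 1)) ≠ 0) :
    Lb = 0 ∧ Lf = 0 ∧ Lh = 0 ∧ Nh 1 = 0 := by
  have hinv := mul_nonsing_inv _ hd.isUnit
  have hht : (h⁻¹)ᵀ = h⁻¹ := by rw [transpose_nonsing_inv, hh]
  have Ha (a) : 2 * Lb (g * a) + ∑ r, a r 1 * Nh 1 (k r) = 0 := by
    -- This β cancels the variation of f and turns that of b into the Schur complement g applied to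
    -- a.
    have h1 := H a (-(h⁻¹ * fᵀ * a)) 0
    have h2 : b * a + f * -(h⁻¹ * fᵀ * a) = g * a := by
      rw [hg, Matrix.sub_mul]
      simp only [Matrix.mul_neg, Matrix.mul_assoc, sub_eq_add_neg]
    have h3 : fᵀ * a + h * -(h⁻¹ * fᵀ * a) = 0 := by
      simp only [Matrix.mul_neg, ← Matrix.mul_assoc, hinv, Matrix.one_mul, add_neg_cancel]
    rw [h2, h3] at h1
    simp only [map_add, hLb, map_sum, map_smul, smul_eq_mul, Matrix.mul_zero, transpose_zero,
      map_zero, add_zero, zero_add] at h1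
    linarith
  have Hκ (κ) : -2 * Lb (f * h⁻¹ * κᵀ * fᵀ) + 2 * Lh (h * κ) + 2 * Nh 1 (k 1 * κ) = 0 := by
    -- Here β compensates the variation fκ of f.
    have h1 := H 0 (-(h⁻¹ * κᵀ * fᵀ)) κ
    have h2 : b * 0 + f * -(h⁻¹ * κᵀ * fᵀ) = -(f * h⁻¹ * κᵀ * fᵀ) := by
      simp only [Matrix.mul_neg, Matrix.mul_assoc, Matrix.mul_zero, zero_add]
    have h3 : (fᵀ * 0 + h * -(h⁻¹ * κᵀ * fᵀ))ᵀ + f * κ = 0 := by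
      simp only [Matrix.mul_neg, ← Matrix.mul_assoc, hinv, Matrix.one_mul, transpose_neg,
        transpose_mul, transpose_transpose, Matrix.mul_zero, zero_add, neg_add_cancel]
    rw [h2, h3] at h1
    simp only [map_add, hLb, hLh, hN, map_neg, map_zero, Matrix.zero_apply, zero_smul,
      Finset.sum_const_zero, add_zero] at h1
    linarith
  have hLb01 : Lb (Matrix.single 1 0 1) = Lb (Matrix.single 0 1 1) := by
    rw [← hLb, transpose_single]
  -- The first column of a does not enter the sum over r, so the first two equations determine `l00`
  -- and `l01`; the other two then express `Nh 1 (k 0)` and `Nh 1 (k 1)` through `l11`.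
  have a00 := Ha (Matrix.single 0 0 1)
  have a10 := Ha (Matrix.single 1 0 1)
  have a01 := Ha (Matrix.single 0 1 1)
  have a11 := Ha (Matrix.single 1 1 1)
  rw [linearMap_apply] at a00 a10 a01 a11
  simp [Matrix.mul_apply, Matrix.single_apply, hLb01, hgs] at a00 a10 a01 a11
  rw [det_fin_two, hgs] at hgd
  set l00 := Lb (Matrix.single 0 0 1)
  set l01 := Lb (Matrix.single 0 1 1)
  set l11 := Lb (Matrix.single 1 1 1)
  have e00 : l00 = 0 := (mul_eq_zero.mp (by linear_combination g 1 1 * a00 - g 0 1 * a10 :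
    (g 0 0 * g 1 1 - g 0 1 * g 0 1) * l00 = 0)).resolve_left hgd
  have e01 : l01 = 0 := (mul_eq_zero.mp (by linear_combination g 0 0 * a10 - g 0 1 * a00 :
    (g 0 0 * g 1 1 - g 0 1 * g 0 1) * l01 = 0)).resolve_left hgd
  have hw : Nh 1 (wedge h (k 1)) = 0 := by
    have hs := congrFun (congrFun hh 0) 1
    have hs1 := congrFun (congrFun (hk 1) 0) 1
    simp only [Matrix.transpose_apply] at hs hs1
    let J : Matrix (Fin 2) (Fin 2) ℝ := !![0, 1; -1, 0]
    have hJ : Jᵀ = -J := by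
      ext i j; fin_cases i <;> fin_cases j <;> simp [J]
    -- Here κ is an infinitesimal rotation of h: hκ = J is antisymmetric, so h is fixed and `Lb`,
    -- `Lh` contribute nothing. What survives is the velocity of k 1 under the rotation,
    -- proportional to `wedge h (k 1)`.
    have h1 := Hκ (h⁻¹ * J)
    have h2 : Lb (f * h⁻¹ * (h⁻¹ * J)ᵀ * fᵀ) = 0 := by
      have h3 := hLb (f * h⁻¹ * (h⁻¹ * J)ᵀ * fᵀ)
      have h4 : (f * h⁻¹ * (h⁻¹ * J)ᵀ * fᵀ)ᵀ = -(f * h⁻¹ * (h⁻¹ * J)ᵀ * fᵀ) := by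
        simp only [transpose_mul, transpose_neg, transpose_transpose, hht, hJ, Matrix.mul_assoc, Matrix.neg_mul,
          Matrix.mul_neg, neg_neg]
      rw [h4, map_neg] at h3
      linarith
    have h5 : Lh J = 0 := by
      have h6 := hLh J
      rw [hJ, map_neg] at h6
      linarith
    rw [h2, ← Matrix.mul_assoc, hinv, Matrix.one_mul, h5] at h1
    have h7 : h.det • ((k 1 * (h⁻¹ * J))ᵀ + k 1 * (h⁻¹ * J)) = wedge h (k 1) := by
      have : h⁻¹ = h.det⁻¹ • !![h 1 1, -h 0 1; -h 1 0, h 0 0] := by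
        rw [Matrix.inv_def, Matrix.adjugate_fin_two, Ring.inverse_eq_inv']
      rw [this, Matrix.smul_mul, Matrix.mul_smul, transpose_smul, ← smul_add, smul_smul,
        mul_inv_cancel₀ hd, one_smul]
      ext i j
      fin_cases i <;> fin_cases j <;>
        simp [Matrix.mul_apply, Fin.sum_univ_two, wedge, J, hs, hs1] <;> ring
    rw [← h7, map_smul, map_add, hN]
    rw [show Nh 1 (k 1 * (h⁻¹ * J)) = 0 by linarith]
    simp
  have hcr (r : Matrix (Fin 2) (Fin 2) ℝ) (hr : r 1 0 = r 0 1) := congrArg (Nh 1)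
    (tri_cramer (congrFun (congrFun hh 0) 1) (congrFun (congrFun (hk 0) 0) 1)
      (congrFun (congrFun (hk 1) 0) 1) hr)
  simp only [map_add, map_smul, V, smul_eq_mul, mul_zero, zero_add] at hcr
  -- Expanding the wedge in the basis h, k 0, k 1 gives a relation between `Nh 1 (k 0)` and `Nh 1 (k
  -- 1)`, hence one for `l11` alone.
  have h1 := hcr (wedge h (k 1)) rfl
  rw [hw] at h1
  have e11 : l11 = 0 := by
    refine (mul_eq_zero.mp (?_ : (g 0 1 * tri h (wedge h (k 1)) (k 1) +
      g 1 1 * tri h (k 0) (wedge h (k 1))) * l11 = 0)).resolve_left hE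
    rw [e01] at a01 a11
    linear_combination (1 / 2) * h1 + (1 / 2) * tri h (wedge h (k 1)) (k 1) * a01 +
      (1 / 2) * tri h (k 0) (wedge h (k 1)) * a11
  have eLb : Lb = 0 := by
    refine linearMap_eq_zero_of_single fun i j => ?_
    fin_cases i <;> fin_cases j
    exacts [e00, e01, hLb01.trans e01, e11]
  have n0 : Nh 1 (k 0) = 0 := by rw [e01, e11] at a01; linarith
  have n1 : Nh 1 (k 1) = 0 := by rw [e01, e11] at a11; linarith
  have eN : Nh 1 = 0 := by
    refine LinearMap.ext fun m => ?_
    have h1 := hcr (m + mᵀ) (by simp [add_comm])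
    rw [n0, n1, mul_zero, mul_zero, add_zero, map_add, hN] at h1
    have := (mul_eq_zero.mp h1).resolve_left hT
    simp only [LinearMap.zero_apply]
    linarith
  refine ⟨eLb, LinearMap.ext fun m => ?_, LinearMap.ext fun m => ?_, eN⟩
  · have h1 := H 0 (h⁻¹ * mᵀ) 0
    simpa [eLb, eN, ← Matrix.mul_assoc, hinv] using h1
  · have h1 := Hκ (h⁻¹ * m)
    rw [eLb, eN, ← Matrix.mul_assoc, hinv] at h1
    simpa using h1

end Forms

/-- The coefficients with given blocks, as a linear map of each block. -/
def blockCoeff : (Matrix (Fin 2) (Fin 2) ℝ × Matrix (Fin 2) (Fin 2) ℝ ×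
    Matrix (Fin 2) (Fin 2) ℝ) →ₗ[ℝ] Coeff where
  toFun m := ofMat (fromBlocks m.1 m.2.1 0 m.2.2)
  map_add' m n := by
    refine Prod.ext ?_ (Prod.ext ?_ ?_)
    · ext z
      induction z with
      | _ i j => simp [ofMat]; ring
    · ext i j; simp [ofMat]
    · ext z
      induction z with
      | _ i j => simp [ofMat]; ring
  map_smul' r m := by
    refine Prod.ext ?_ (Prod.ext ?_ ?_)
    · ext z
      induction z with
      | _ i j => simp [ofMat]; ring
    · ext i j; simp [ofMat]
    · ext z
      induction z with
      | _ i j => simp [ofMat]; ring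

/-- The lower left block is never read by `ofMat`, so it may be arbitrary. -/
lemma ofMat_fromBlocks (b f f' h : Matrix (Fin 2) (Fin 2) ℝ) :
    ofMat (fromBlocks b f f' h) = blockCoeff (b, f, h) := rfl

lemma ofMat_metric (c : Coeff) : ofMat (metric c) = c :=
  metric_injective (metric_ofMat (metric_transpose c))

lemma blockCoeff_transpose (b f h : Matrix (Fin 2) (Fin 2) ℝ) :
    blockCoeff (bᵀ, f, hᵀ) = blockCoeff (b, f, h) := by
  refine Prod.ext ?_ (Prod.ext ?_ ?_)
  · ext z
    induction z with
    | _ i j => simp [blockCoeff, ofMat, add_comm]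
  · ext i j; simp [blockCoeff, ofMat]
  · ext z
    induction z with
    | _ i j => simp [blockCoeff, ofMat, add_comm]

/-- The jet with one nonvanishing derivative. -/
def derivDir (s : Fin 2) (b f h : Matrix (Fin 2) (Fin 2) ℝ) : Jet :=
  (0, 0, Pi.single s (blockCoeff (b, f, h)))

/-- Six directions complementary to the orbits at a generic jet. -/
def transversal (x : Jet) : Fin 6 → Jet :=
  ![derivDir 0 0 0 (hMat (coeff x)), derivDir 1 0 0 (hMat (coeff x)),
    derivDir 0 0 0 (hMat (x.2.2 1)), derivDir 0 0 0 (hMat (x.2.2 0)),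
    derivDir 1 0 (Matrix.single 0 0 1 * hMat (coeff x)) 0,
    derivDir 1 0 (Matrix.single 0 1 1 * hMat (coeff x)) 0]

/-- The jets at which the orbits have codimension six. -/
def RegularAt (x : Jet) : Prop :=
  tri (hMat (coeff x)) (hMat (x.2.2 0)) (hMat (x.2.2 1)) ≠ 0 ∧
  orbitMetric (coeff x) 0 1 *
      tri (hMat (coeff x)) (wedge (hMat (coeff x)) (hMat (x.2.2 1))) (hMat (x.2.2 1)) +
    orbitMetric (coeff x) 1 1 *
      tri (hMat (coeff x)) (hMat (x.2.2 0)) (wedge (hMat (coeff x)) (hMat (x.2.2 1))) ≠ 0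

section

variable (ν : Coeff →ₗ[ℝ] ℝ)

/-- The restriction of a linear form on coefficients to the block `b`. -/
def formB : Matrix (Fin 2) (Fin 2) ℝ →ₗ[ℝ] ℝ := ν ∘ₗ blockCoeff ∘ₗ LinearMap.inl ℝ _ _

/-- The restriction of a linear form on coefficients to the block `f`. -/
def formF : Matrix (Fin 2) (Fin 2) ℝ →ₗ[ℝ] ℝ :=
  ν ∘ₗ blockCoeff ∘ₗ LinearMap.inr ℝ _ _ ∘ₗ LinearMap.inl ℝ _ _

/-- The restriction of a linear form on coefficients to the block `h`. -/
def formH : Matrix (Fin 2) (Fin 2) ℝ →ₗ[ℝ] ℝ :=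
  ν ∘ₗ blockCoeff ∘ₗ LinearMap.inr ℝ _ _ ∘ₗ LinearMap.inr ℝ _ _

lemma form_apply (b f h : Matrix (Fin 2) (Fin 2) ℝ) :
    ν (blockCoeff (b, f, h)) = formB ν b + formF ν f + formH ν h := by
  simp only [formB, formF, formH, LinearMap.comp_apply, ← map_add]
  congr 2
  simp

lemma formB_transpose (b : Matrix (Fin 2) (Fin 2) ℝ) : formB ν bᵀ = formB ν b := by
  have h := congrArg ν (blockCoeff_transpose b 0 0)
  rwa [transpose_zero] at h

lemma formH_transpose (h : Matrix (Fin 2) (Fin 2) ℝ) : formH ν hᵀ = formH ν h := by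
  have h' := congrArg ν (blockCoeff_transpose 0 0 h)
  rwa [transpose_zero] at h'

lemma form_eq_zero (hB : formB ν = 0) (hF : formF ν = 0) (hH : formH ν = 0) : ν = 0 := by
  refine LinearMap.ext fun c => ?_
  rw [← ofMat_metric c, metric, ofMat_fromBlocks, form_apply, hB, hF, hH]
  simp

end

/-- The covector is split into its components on b, f, h and their derivatives, which are eliminated
from the highest order down. Together with the 28 generators, the six transversal vectors thus span
the jet space at a regular jet. -/
lemma eq_zero_of_tangent_of_transversal {x : Jet} (hx : x ∈ J1) (hr : RegularAt x)
    (μ : Jet →L[ℝ] ℝ) (H : ∀ g : Generator, μ (g.v, 0, 0) = μ (g.tangent x))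
    (V : ∀ j, μ (transversal x j) = 0) : μ = 0 := by
  let ν₀ : Coeff →ₗ[ℝ] ℝ := (μ : Jet →ₗ[ℝ] ℝ) ∘ₗ LinearMap.inr ℝ _ _ ∘ₗ LinearMap.inl ℝ _ _
  let ν : Fin 2 → Coeff →ₗ[ℝ] ℝ := fun s =>
    (μ : Jet →ₗ[ℝ] ℝ) ∘ₗ LinearMap.inr ℝ _ _ ∘ₗ LinearMap.inr ℝ _ _ ∘ₗ LinearMap.single ℝ (fun _ => Coeff) s
  let μ₀ : M →ₗ[ℝ] ℝ := (μ : Jet →ₗ[ℝ] ℝ) ∘ₗ LinearMap.inl ℝ _ _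
  have hμ (y : Jet) : μ y = μ₀ y.1 + ν₀ y.2.1 + ∑ s, ν s (y.2.2 s) := by
    obtain ⟨p, c, d⟩ := y
    simp only [μ₀, ν₀, ν, LinearMap.comp_apply, ContinuousLinearMap.coe_coe, Fin.sum_univ_two,
      ← map_add]
    congr 1
    refine Prod.ext (by simp) (Prod.ext (by simp) (funext fun s => ?_))
    fin_cases s <;> simp
  have hdir (s : Fin 2) (b f h : Matrix (Fin 2) (Fin 2) ℝ) :
      μ (derivDir s b f h) = ν s (blockCoeff (b, f, h)) := rfl
  have hH (m : Matrix (Fin 2) (Fin 2) ℝ) (s : Fin 2) :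
      μ (derivDir s 0 0 m) = formH (ν s) m := by
    rw [hdir, form_apply]; simp
  have hF (m : Matrix (Fin 2) (Fin 2) ℝ) (s : Fin 2) :
      μ (derivDir s 0 m 0) = formF (ν s) m := by
    rw [hdir, form_apply]; simp
  have V0 := (hH _ _).symm.trans (V 0)
  have V1 := (hH _ _).symm.trans (V 1)
  have V2 := (hH _ _).symm.trans (V 2)
  have V3 := (hH _ _).symm.trans (V 3)
  have V4 := (hF _ _).symm.trans (V 4)
  have V5 := (hF _ _).symm.trans (V 5)
  set b := bMat (coeff x)
  set f := fMat (coeff x)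
  set h := hMat (coeff x)
  have Hg (a β κ : Matrix (Fin 2) (Fin 2) ℝ) (Φ Ψ : Fin 2 → Matrix (Fin 2) (Fin 2) ℝ)
      (hΦ : ∀ i j k, Φ i k j = Φ j k i) (hΨ : ∀ i j k, Ψ i k j = Ψ j k i) :
      formB ν₀ ((b * a + f * β)ᵀ + (b * a + f * β)) + formF ν₀ ((fᵀ * a + h * β)ᵀ + f * κ) +
        formH ν₀ ((h * κ)ᵀ + h * κ) + ∑ s, (
        formB (ν s) ((b * Φ s + f * Ψ s)ᵀ + (b * Φ s + f * Ψ s) +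
          ((bMat (x.2.2 s) * a + fMat (x.2.2 s) * β)ᵀ +
          (bMat (x.2.2 s) * a + fMat (x.2.2 s) * β) + ∑ r, a r s • bMat (x.2.2 r))) +
        formF (ν s) ((fᵀ * Φ s + h * Ψ s)ᵀ + (aᵀ * fMat (x.2.2 s) + βᵀ * hMat (x.2.2 s) +
          fMat (x.2.2 s) * κ + ∑ r, a r s • fMat (x.2.2 r))) +
        formH (ν s) ((hMat (x.2.2 s) * κ)ᵀ + hMat (x.2.2 s) * κ +
          ∑ r, a r s • hMat (x.2.2 r))) = 0 := by
    have h1 := (H ⟨0, a, β, κ, Φ, Ψ, hΦ, hΨ⟩).symm.trans (map_zero μ)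
    simp only [hμ, Generator.tangent, Generator.X, Generator.Y, metric, fromBlocks_transpose,
      fromBlocks_multiply, fromBlocks_smul, fromBlocks_add, Fin.sum_univ_two, ofMat_fromBlocks,
      form_apply, map_zero, zero_add] at h1
    rw [← h1, Fin.sum_univ_two]
    simp only [Fin.sum_univ_two]
    congr 1
    · congr 1
      · congr 2 <;> simp [transpose_mul, hMat_transpose, bMat_transpose, b, f, h]
      · congr 1
        simp [transpose_mul, hMat_transpose, h]
    · congr 1 <;> congr 1 <;> congr 1 <;> congr 1 <;>
      · simp [transpose_mul, hMat_transpose, bMat_transpose, b, f, h]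
        try abel
  have hzero : ∀ i j k : Fin 2, (0 : Fin 2 → Matrix (Fin 2) (Fin 2) ℝ) i k j =
    (0 : Fin 2 → Matrix (Fin 2) (Fin 2) ℝ) j k i := fun _ _ _ => rfl
  have eNb : ∀ s, formB (ν s) = 0 := by
    refine Nb_eq_zero (Nf := fun s => formF (ν s)) (b := b) (f := f) (h := h)
      (fun s => formB_transpose _) hx.2 rfl (detG_ne_zero hx) fun Φ Ψ hΦ hΨ => ?_
    have h1 := Hg 0 0 0 Φ Ψ hΦ hΨ
    simpa using h1
  have eNf : ∀ s, formF (ν s) = 0 := by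
    refine Nf_eq_zero (Nf := fun s => formF (ν s)) (h := h) hx.2 (fun Ψ hΨ => ?_)
      (Fin.forall_fin_two.mpr ⟨V4, V5⟩)
    have h1 := Hg 0 0 0 0 Ψ hzero hΨ
    simpa [eNb, h, hMat_transpose] using h1
  have eNh0 : formH (ν 0) = 0 :=
    Nh_zero_eq_zero (Nh := fun s => formH (ν s)) (k := fun s => hMat (x.2.2 s))
      (formH_transpose _) (hMat_transpose _)
      (fun s => hMat_transpose _) hr.1 V0 V3 V2
  obtain ⟨eLb, eLf, eLh, eNh1⟩ := forms_eq_zero (Lb := formB ν₀) (Lf := formF ν₀) (Lh := formH ν₀)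
    (Nh := fun s => formH (ν s)) (b := b) (f := f) (h := h) (k := fun s => hMat (x.2.2 s))
    (g := orbitMetric (coeff x)) (formB_transpose _) (formH_transpose _) (formH_transpose _) hx.2
    (hMat_transpose _) (fun s => hMat_transpose _) rfl (detG_ne_zero hx) (orbitMetric_symm _)
    (fun a β κ => by
      have h1 := Hg a β κ 0 0 hzero hzero
      rw [Fin.sum_univ_two, eNb, eNb, eNf, eNf, eNh0] at h1
      simpa only [LinearMap.zero_apply, zero_add] using h1) V1 hr.1 hr.2
  have eν₀ : ν₀ = 0 := form_eq_zero _ eLb eLf eLh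
  have eν : ∀ s, ν s = 0 := Fin.forall_fin_two.mpr
    ⟨form_eq_zero _ (eNb 0) (eNf 0) eNh0, form_eq_zero _ (eNb 1) (eNf 1) eNh1⟩
  -- A pure translation leaves all fibre coordinates unchanged.
  have eμ₀ : μ₀ = 0 := by
    refine LinearMap.ext fun v => (H ⟨v, 0, 0, 0, 0, 0, hzero, hzero⟩).trans ?_
    rw [hμ, eν₀]
    simp [eν, Generator.tangent]
  refine ContinuousLinearMap.ext fun y => ?_
  rw [hμ, eμ₀, eν₀]
  simp [eν]

/-! ### Maximality -/

lemma IsInvariant.mono {U V : Set Jet} {F : Jet → ℝ} (hF : IsInvariant V F) (h : U ⊆ V) :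
    IsInvariant U F :=
  ⟨hF.smooth.mono h, fun P W s s' hP hT p hp h1 h2 =>
    hF.invariant P W s s' hP hT p hp (h h1) (h h2)⟩

/-- Evaluating seven differentials on the six transversal vectors gives a map from ℝ⁷ to ℝ⁶; an
element of its kernel is a combination annihilating the orbits and the transversal, hence a linear
relation. -/
lemma not_functionallyIndependentAt {U : Set Jet} (hU : IsOpen U) (hJ : U ⊆ J1)
    {F : Fin 7 → Jet → ℝ} (hF : ∀ i, IsInvariant U (F i)) {x : Jet} (hx : x ∈ U)
    (hr : RegularAt x) : ¬ FunctionallyIndependentAt F x := by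
  intro hli
  let L : (Fin 7 → ℝ) →ₗ[ℝ] (Fin 6 → ℝ) :=
    Matrix.mulVecLin (Matrix.of fun j i => fderiv ℝ (F i) x (transversal x j))
  obtain ⟨l, hl, hl0⟩ : ∃ l ∈ LinearMap.ker L, l ≠ 0 :=
    Submodule.exists_mem_ne_zero_of_ne_bot (LinearMap.ker_ne_bot_of_finrank_lt (by simp))
  have hsum : ∑ i, l i • fderiv ℝ (F i) x = 0 := by
    refine eq_zero_of_tangent_of_transversal (hJ hx) hr _ (fun g => ?_) fun j => ?_
    · simp only [_root_.sum_apply, _root_.smul_apply,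
        (hF _).fderiv_tangent hU hx g]
    · have := congrFun (LinearMap.mem_ker.mp hl) j
      simpa [L, Matrix.mulVec, dotProduct, mul_comm] using this
  exact hl0 (funext (Fintype.linearIndependent_iff.mp hli l hsum))

lemma isOpen_setOf_functionallyIndependentAt {n : ℕ} {U : Set Jet} (hU : IsOpen U)
    {F : Fin n → Jet → ℝ} (hF : ∀ i, ContDiffOn ℝ ∞ (F i) U) :
    IsOpen (U ∩ {x | FunctionallyIndependentAt F x}) := by
  have hc : ContinuousOn (fun x i => fderiv ℝ (F i) x) U :=
    continuousOn_pi.mpr fun i => (hF i).continuousOn_fderiv_of_isOpen hU (by simp)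
  exact hc.isOpen_inter_preimage hU isOpen_setOfPred_linearIndependent

/-! ### Differentials of the invariants along the fibres of `J¹τ → τ` -/

section Derivatives

variable {x : Jet} {w : Fin 2 → Coeff}

/-- The components of `σ`, up to a factor. -/
def sig (x : Jet) (i : Fin 2) : ℝ := polar (hMat (coeff x)) (hMat (x.2.2 i))

/-- The components of `χ`, up to a factor. -/
def chiNum (x : Jet) (i j : Fin 2) : ℝ := polar (hMat (x.2.2 i)) (hMat (x.2.2 j))

lemma line_mem_J1 (hx : x ∈ J1) (t : ℝ) : x + t • ((0, 0, w) : Jet) ∈ J1 := by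
  simpa [J1, coeff] using hx

lemma coeff_line (t : ℝ) : coeff (x + t • ((0, 0, w) : Jet)) = coeff x := by
  simp [coeff]

lemma deriv_line (t : ℝ) (s : Fin 2) :
    (x + t • ((0, 0, w) : Jet)).2.2 s = x.2.2 s + t • w s := by
  simp

lemma hMat_add_smul (c c' : Coeff) (t : ℝ) : hMat (c + t • c') = hMat c + t • hMat c' := by
  ext i j; simp [hMat]

lemma fMat_add_smul (c c' : Coeff) (t : ℝ) : fMat (c + t • c') = fMat c + t • fMat c' := by
  ext i j; simp [fMat]

lemma fderiv_apply_eq {I : Jet → ℝ} {v : Jet} {d : ℝ} (hI : DifferentiableAt ℝ I x)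
    (h : HasDerivAt (fun t : ℝ => I (x + t • v)) d 0) : fderiv ℝ I x v = d := by
  have h1 : HasDerivAt (fun t : ℝ => x + t • v) v 0 := by
    simpa using ((hasDerivAt_id' (0 : ℝ)).smul_const v).const_add x
  have h2 := HasFDerivAt.comp_hasDerivAt (0 : ℝ) (l' := fderiv ℝ I x) (l := I)
    (by simpa using hI.hasFDerivAt) h1
  exact h2.unique h

/-- The variation of `sig`. -/
def sigVar (x : Jet) (w : Fin 2 → Coeff) (i : Fin 2) : ℝ := polar (hMat (coeff x)) (hMat (w i))

/-- The variation of `chiNum`. -/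
def chiVar (x : Jet) (w : Fin 2 → Coeff) (i j : Fin 2) : ℝ :=
  polar (hMat (w i)) (hMat (x.2.2 j)) + polar (hMat (x.2.2 i)) (hMat (w j))

lemma hasDerivAt_sig (i : Fin 2) :
    HasDerivAt (fun t : ℝ => sig (x + t • ((0, 0, w) : Jet)) i) (sigVar x w i) 0 := by
  have h : (fun t : ℝ => sig (x + t • ((0, 0, w) : Jet)) i) =
      fun t => sig x i + t * sigVar x w i := by
    ext t
    simp only [sig, sigVar, coeff_line, deriv_line, hMat_add_smul, polar, Matrix.add_apply,
      Matrix.smul_apply, smul_eq_mul]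
    ring
  rw [h]
  simpa only [one_mul] using ((hasDerivAt_id' (0 : ℝ)).mul_const (sigVar x w i)).const_add (sig x i)

lemma hasDerivAt_chiNum (i j : Fin 2) :
    HasDerivAt (fun t : ℝ => chiNum (x + t • ((0, 0, w) : Jet)) i j) (chiVar x w i j) 0 := by
  have h : (fun t : ℝ => chiNum (x + t • ((0, 0, w) : Jet)) i j) =
      fun t => chiNum x i j + t * chiVar x w i j + t ^ 2 * polar (hMat (w i)) (hMat (w j)) := by
    ext t
    simp only [chiNum, chiVar, deriv_line, hMat_add_smul, polar, Matrix.add_apply,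
      Matrix.smul_apply, smul_eq_mul]
    ring
  rw [h]
  have h1 := (((hasDerivAt_id' (0 : ℝ)).mul_const (chiVar x w i j)).const_add (chiNum x i j)).add
    ((hasDerivAt_pow 2 (0 : ℝ)).mul_const (polar (hMat (w i)) (hMat (w j))))
  exact h1.congr_deriv (by simp)

lemma invariants_zero_eq (x : Jet) : invariants 0 x =
    (orbitMetric (coeff x) 1 1 * sig x 0 ^ 2 - 2 * orbitMetric (coeff x) 0 1 * sig x 0 * sig x 1 +
      orbitMetric (coeff x) 0 0 * sig x 1 ^ 2) / (detG x * detH x ^ 2) := by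
  change traceInv rho x = _
  simp only [traceInv, rho, sigma_eq, inv_orbitMetric, Fin.sum_univ_two, Matrix.of_apply,
    Matrix.smul_apply, smul_eq_mul, sig, detG, orbitMetric_symm, div_eq_mul_inv, mul_inv]
  simp
  ring

lemma invariants_one_eq (x : Jet) : invariants 1 x =
    (orbitMetric (coeff x) 1 1 * chiNum x 0 0 - 2 * orbitMetric (coeff x) 0 1 * chiNum x 0 1 +
      orbitMetric (coeff x) 0 0 * chiNum x 1 1) / (2 * detG x * detH x) := by
  change traceInv chi x = _
  simp only [traceInv, chi_eq, inv_orbitMetric, Fin.sum_univ_two,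
    Matrix.smul_apply, smul_eq_mul, chiNum, detG, orbitMetric_symm, div_eq_mul_inv, mul_inv,
    polar_comm (hMat (x.2.2 1)) (hMat (x.2.2 0))]
  simp
  ring

lemma invariants_two_eq (x : Jet) : invariants 2 x =
    (chiNum x 0 0 * chiNum x 1 1 - chiNum x 0 1 ^ 2) / (4 * detH x ^ 2 * detG x) := by
  change detInv chi x = _
  simp only [detInv, Matrix.det_fin_two, chi_eq, chiNum, div_eq_mul_inv, mul_inv,
    polar_comm (hMat (x.2.2 1)) (hMat (x.2.2 0))]
  ring

lemma invariants_three_eq (hx : x ∈ J1) : invariants 3 x =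
    ((2 * detH x * chiNum x 0 0 - sig x 0 ^ 2) * (2 * detH x * chiNum x 1 1 - sig x 1 ^ 2) -
      (2 * detH x * chiNum x 0 1 - sig x 0 * sig x 1) ^ 2) / (16 * detH x ^ 4 * detG x) := by
  have hH := detH_ne_zero hx
  have hG := detG_ne_zero hx
  change detInv gam x = _
  simp only [detInv, gam, Matrix.det_fin_two, Matrix.sub_apply, Matrix.smul_apply, smul_eq_mul,
    rho, Matrix.of_apply, chi_eq, sigma_eq, chiNum, sig,
    polar_comm (hMat (x.2.2 1)) (hMat (x.2.2 0))]
  field_simp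
  ring

lemma detG_line (t : ℝ) : detG (x + t • ((0, 0, w) : Jet)) = detG x := by
  rw [detG, coeff_line, detG]

lemma detH_line (t : ℝ) : detH (x + t • ((0, 0, w) : Jet)) = detH x := by
  rw [detH, coeff_line, detH]

lemma differentiableAt_invariants (hx : x ∈ J1) (i : Fin 6) :
    DifferentiableAt ℝ (invariants i) x :=
  (contDiffAt_invariants (n := 1) hx i).differentiableAt (by simp)

lemma fderiv_invariants_zero (hx : x ∈ J1) : fderiv ℝ (invariants 0) x (0, 0, w) =
    (2 * orbitMetric (coeff x) 1 1 * sig x 0 * sigVar x w 0 -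
      2 * orbitMetric (coeff x) 0 1 * (sigVar x w 0 * sig x 1 + sig x 0 * sigVar x w 1) +
      2 * orbitMetric (coeff x) 0 0 * sig x 1 * sigVar x w 1) / (detG x * detH x ^ 2) := by
  refine fderiv_apply_eq (differentiableAt_invariants hx 0) ?_
  simp only [invariants_zero_eq, coeff_line, detG_line, detH_line]
  have h0 := hasDerivAt_sig (x := x) (w := w) 0
  have h1 := hasDerivAt_sig (x := x) (w := w) 1
  have h := ((((h0.pow 2).const_mul (orbitMetric (coeff x) 1 1)).sub
    ((h0.const_mul (2 * orbitMetric (coeff x) 0 1)).mul h1)).add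
    ((h1.pow 2).const_mul (orbitMetric (coeff x) 0 0))).div_const (detG x * detH x ^ 2)
  refine h.congr_deriv ?_
  simp only [zero_smul, add_zero]
  ring

lemma fderiv_invariants_one (hx : x ∈ J1) : fderiv ℝ (invariants 1) x (0, 0, w) =
    (orbitMetric (coeff x) 1 1 * chiVar x w 0 0 - 2 * orbitMetric (coeff x) 0 1 * chiVar x w 0 1 +
      orbitMetric (coeff x) 0 0 * chiVar x w 1 1) / (2 * detG x * detH x) := by
  refine fderiv_apply_eq (differentiableAt_invariants hx 1) ?_
  simp only [invariants_one_eq, coeff_line, detG_line, detH_line]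
  exact ((((hasDerivAt_chiNum 0 0).const_mul _).sub ((hasDerivAt_chiNum 0 1).const_mul _)).add
    ((hasDerivAt_chiNum 1 1).const_mul _)).div_const _

lemma fderiv_invariants_two (hx : x ∈ J1) : fderiv ℝ (invariants 2) x (0, 0, w) =
    (chiVar x w 0 0 * chiNum x 1 1 + chiNum x 0 0 * chiVar x w 1 1 -
      2 * chiNum x 0 1 * chiVar x w 0 1) / (4 * detH x ^ 2 * detG x) := by
  refine fderiv_apply_eq (differentiableAt_invariants hx 2) ?_
  simp only [invariants_two_eq, detG_line, detH_line]
  have h00 := hasDerivAt_chiNum (x := x) (w := w) 0 0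
  have h01 := hasDerivAt_chiNum (x := x) (w := w) 0 1
  have h11 := hasDerivAt_chiNum (x := x) (w := w) 1 1
  have h := ((h00.mul h11).sub (h01.pow 2)).div_const (4 * detH x ^ 2 * detG x)
  refine h.congr_deriv ?_
  simp only [zero_smul, add_zero]
  ring

lemma fderiv_invariants_three (hx : x ∈ J1) : fderiv ℝ (invariants 3) x (0, 0, w) =
    ((2 * detH x * chiVar x w 0 0 - 2 * sig x 0 * sigVar x w 0) *
        (2 * detH x * chiNum x 1 1 - sig x 1 ^ 2) +
      (2 * detH x * chiNum x 0 0 - sig x 0 ^ 2) *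
        (2 * detH x * chiVar x w 1 1 - 2 * sig x 1 * sigVar x w 1) -
      2 * (2 * detH x * chiNum x 0 1 - sig x 0 * sig x 1) *
        (2 * detH x * chiVar x w 0 1 - (sigVar x w 0 * sig x 1 + sig x 0 * sigVar x w 1))) /
      (16 * detH x ^ 4 * detG x) := by
  refine fderiv_apply_eq (differentiableAt_invariants hx 3) ?_
  have h0 := hasDerivAt_sig (x := x) (w := w) 0
  have h1 := hasDerivAt_sig (x := x) (w := w) 1
  simp only [invariants_three_eq (line_mem_J1 hx _), detG_line, detH_line]
  have h00 := hasDerivAt_chiNum (x := x) (w := w) 0 0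
  have h01 := hasDerivAt_chiNum (x := x) (w := w) 0 1
  have h11 := hasDerivAt_chiNum (x := x) (w := w) 1 1
  have h := (((h00.const_mul (2 * detH x)).sub (h0.pow 2)).mul
      ((h11.const_mul (2 * detH x)).sub (h1.pow 2))).sub
    (((h01.const_mul (2 * detH x)).sub (h0.mul h1)).pow 2)
    |>.div_const (16 * detH x ^ 4 * detG x)
  refine h.congr_deriv ?_
  simp only [zero_smul, add_zero, Pi.mul_apply, Pi.sub_apply, Pi.pow_apply]
  ring

/-- The derivatives of the quadratic form `h_{kl} cᵏ cˡ`. -/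
def normGrad (h : Matrix (Fin 2) (Fin 2) ℝ) (c : Fin 2 → ℝ) : Fin 2 → ℝ :=
  ![2 * (h 0 0 * c 0 + h 0 1 * c 1), 2 * (h 0 1 * c 0 + h 1 1 * c 1)]

/-- The derivatives of the quadratic form `triple m n`. -/
def tripleGrad (m n : Matrix (Fin 2) (Fin 2) ℝ) (c : Fin 2 → ℝ) : Fin 2 → ℝ :=
  ![2 * c 0 * (m 0 0 * n 0 1 - m 0 1 * n 0 0) + c 1 * (m 0 0 * n 1 1 - m 1 1 * n 0 0),
    c 0 * (m 0 0 * n 1 1 - m 1 1 * n 0 0) + 2 * c 1 * (m 0 1 * n 1 1 - m 1 1 * n 0 1)]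

/-- With h and its derivatives held fixed, the curvature is affine in the derivatives of f. -/
lemma ehresmann_line (hx : x ∈ J1) (hw : ∀ s, hMat (w s) = 0) (t : ℝ) (k : Fin 2) :
    ehresmann (x + t • ((0, 0, w) : Jet)) k = ehresmann x k +
      t * ((fMat (w 1) * (hMat (coeff x))⁻¹) 0 k - (fMat (w 0) * (hMat (coeff x))⁻¹) 1 k) := by
  have h (s : Fin 2) : dfUp s (x + t • ((0, 0, w) : Jet)) =
      dfUp s x + t • (fMat (w s) * (hMat (coeff x))⁻¹) := by
    rw [dfUp_eq (line_mem_J1 hx t).2, dfUp_eq hx.2, coeff_line, deriv_line, hMat_add_smul,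
      fMat_add_smul, hw, smul_zero, add_zero, add_sub_right_comm, Matrix.add_mul, Matrix.smul_mul]
  simp only [ehresmann_eq, h, Matrix.add_apply, Matrix.smul_apply, smul_eq_mul]
  ring

lemma fderiv_ellC (hx : x ∈ J1) (hw : ∀ s, hMat (w s) = 0) {k : Fin 2}
    (hk : ∀ l, (fMat (w 1) * (hMat (coeff x))⁻¹) 0 l - (fMat (w 0) * (hMat (coeff x))⁻¹) 1 l =
      (Pi.single k 1 : Fin 2 → ℝ) l) :
    fderiv ℝ (invariants 4) x (0, 0, w) =
      normGrad (hMat (coeff x)) (ehresmann x) k / |detG x| := by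
  refine fderiv_apply_eq (differentiableAt_invariants hx 4) ?_
  change HasDerivAt (fun t => ellC (x + t • ((0, 0, w) : Jet))) _ 0
  simp only [ellC_eq, detG_line, coeff_line, ehresmann_line hx hw, hk]
  refine HasDerivAt.div_const ?_ _
  have hc (l : Fin 2) := ((hasDerivAt_id' (0 : ℝ)).mul_const ((Pi.single k 1 : Fin 2 → ℝ) l)).const_add
    (ehresmann x l)
  have h := HasDerivAt.fun_sum fun i (_ : i ∈ Finset.univ) =>
    HasDerivAt.fun_sum fun j (_ : j ∈ Finset.univ) =>
      ((hc i).const_mul (hMat (coeff x) i j)).mul (hc j)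
  refine h.congr_deriv ?_
  fin_cases k <;> simp [normGrad, Fin.sum_univ_two, hMat_symm] <;> ring

lemma fderiv_thetaI_sq (hx : x ∈ J1) (hw : ∀ s, hMat (w s) = 0) {k : Fin 2}
    (hk : ∀ l, (fMat (w 1) * (hMat (coeff x))⁻¹) 0 l - (fMat (w 0) * (hMat (coeff x))⁻¹) 1 l =
      (Pi.single k 1 : Fin 2 → ℝ) l) :
    fderiv ℝ (invariants 5) x (0, 0, w) =
      2 * triple (hMat (x.2.2 0)) (hMat (x.2.2 1)) (ehresmann x) *
        tripleGrad (hMat (x.2.2 0)) (hMat (x.2.2 1)) (ehresmann x) k /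
        (|detH x| * |detG x| ^ 3) := by
  refine fderiv_apply_eq (differentiableAt_invariants hx 5) ?_
  change HasDerivAt (fun t => thetaI (x + t • ((0, 0, w) : Jet)) ^ 2) _ 0
  simp only [thetaI_eq, detG_line, detH_line, triple, ehresmann_line hx hw, hk, deriv_line,
    hMat_add_smul, hw, smul_zero, add_zero]
  refine HasDerivAt.div_const ?_ _
  have hc (l : Fin 2) := ((hasDerivAt_id' (0 : ℝ)).mul_const ((Pi.single k 1 : Fin 2 → ℝ) l)).const_add
    (ehresmann x l)
  have h := ((((hc 1).pow 2).const_mul (hMat (x.2.2 0) 0 1 * hMat (x.2.2 1) 1 1 -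
    hMat (x.2.2 0) 1 1 * hMat (x.2.2 1) 0 1)).add
    ((((hc 0).mul (hc 1)).const_mul (hMat (x.2.2 0) 0 0 * hMat (x.2.2 1) 1 1 -
    hMat (x.2.2 0) 1 1 * hMat (x.2.2 1) 0 0)).add
    (((hc 0).pow 2).const_mul (hMat (x.2.2 0) 0 0 * hMat (x.2.2 1) 0 1 -
    hMat (x.2.2 0) 0 1 * hMat (x.2.2 1) 0 0)))).pow 2
  refine (h.congr_of_eventuallyEq (Filter.Eventually.of_forall fun t => ?_)).congr_deriv ?_
  · simp [det_fin_three]; ring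
  · fin_cases k <;> simp [tripleGrad, det_fin_three] <;> ring

end Derivatives

/-! ### Generic independence -/

/-- The first degeneracy form. -/
def degen₁ (g h m n : Matrix (Fin 2) (Fin 2) ℝ) : ℝ :=
  g 0 1 * tri h (wedge h n) n + g 1 1 * tri h m (wedge h n)

/-- The second degeneracy form. -/
def degen₂ (g h m n : Matrix (Fin 2) (Fin 2) ℝ) : ℝ :=
  (g 1 1 * polar h m - g 0 1 * polar h n) * (polar h n * polar m m - polar h m * polar m n) -
    (g 0 0 * polar h n - g 0 1 * polar h m) * (polar h m * polar n n - polar m n * polar h n)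

/-- The third degeneracy form. -/
def degen₃ (h m n : Matrix (Fin 2) (Fin 2) ℝ) (c : Fin 2 → ℝ) : ℝ :=
  normGrad h c 0 * tripleGrad m n c 1 - normGrad h c 1 * tripleGrad m n c 0

/-- The jets at which the six invariants are shown to be independent. -/
structure GenericAt (x : Jet) : Prop where
  tri_ne : tri (hMat (coeff x)) (hMat (x.2.2 0)) (hMat (x.2.2 1)) ≠ 0
  degen₁_ne :
    degen₁ (orbitMetric (coeff x)) (hMat (coeff x)) (hMat (x.2.2 0)) (hMat (x.2.2 1)) ≠ 0
  degen₂_ne :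
    degen₂ (orbitMetric (coeff x)) (hMat (coeff x)) (hMat (x.2.2 0)) (hMat (x.2.2 1)) ≠ 0
  triple_ne : triple (hMat (x.2.2 0)) (hMat (x.2.2 1)) (ehresmann x) ≠ 0
  degen₃_ne :
    degen₃ (hMat (coeff x)) (hMat (x.2.2 0)) (hMat (x.2.2 1)) (ehresmann x) ≠ 0

lemma GenericAt.regularAt {x : Jet} (h : GenericAt x) : RegularAt x := ⟨h.tri_ne, h.degen₁_ne⟩

lemma hMat_blockCoeff (b f h : Matrix (Fin 2) (Fin 2) ℝ) (hh : hᵀ = h) :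
    hMat (blockCoeff (b, f, h)) = h := by
  have h1 (i j) : h i j = h j i := congrFun (congrFun hh j) i
  ext i j
  simp [hMat, blockCoeff, ofMat, h1 j i]

lemma fMat_blockCoeff (b f h : Matrix (Fin 2) (Fin 2) ℝ) : fMat (blockCoeff (b, f, h)) = f := by
  ext i j
  simp [fMat, blockCoeff, ofMat]

lemma bMat_blockCoeff (b f h : Matrix (Fin 2) (Fin 2) ℝ) (hb : bᵀ = b) :
    bMat (blockCoeff (b, f, h)) = b := by
  have h1 (i j) : b i j = b j i := congrFun (congrFun hb j) i
  ext i j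
  simp [bMat, blockCoeff, ofMat, h1 j i]

lemma hMat_zero : hMat 0 = 0 := by
  ext i j; simp [hMat]

lemma hMat_single (s r : Fin 2) (f h : Matrix (Fin 2) (Fin 2) ℝ) (hh : hᵀ = h) :
    hMat ((Pi.single s (blockCoeff (0, f, h)) : Fin 2 → Coeff) r) =
      (Pi.single s h : Fin 2 → Matrix (Fin 2) (Fin 2) ℝ) r := by
  rcases eq_or_ne r s with rfl | hr
  · simp [hMat_blockCoeff _ _ _ hh]
  · simp only [Pi.single_eq_of_ne hr]; ext i j; simp [hMat]

lemma fMat_single (s r : Fin 2) (f h : Matrix (Fin 2) (Fin 2) ℝ) :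
    fMat ((Pi.single s (blockCoeff (0, f, h)) : Fin 2 → Coeff) r) =
      (Pi.single s f : Fin 2 → Matrix (Fin 2) (Fin 2) ℝ) r := by
  rcases eq_or_ne r s with rfl | hr
  · simp [fMat_blockCoeff]
  · simp only [Pi.single_eq_of_ne hr]; ext i j; simp [fMat]

lemma polar_zero_left (m : Matrix (Fin 2) (Fin 2) ℝ) : polar 0 m = 0 := by simp [polar]

lemma polar_zero_right (m : Matrix (Fin 2) (Fin 2) ℝ) : polar m 0 = 0 := by simp [polar]

lemma polar_self (m : Matrix (Fin 2) (Fin 2) ℝ) : polar m m = 2 * m.det := by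
  simp [polar, det_fin_two]; ring

/-- A linear relation is evaluated on the vectors of `transversal`. The two f-directions see only
ℓ_𝒞 and Θ_I², with determinant proportional to `degen₃`. Among the four h-directions, those along h
leave Q_γ stationary, since 2 det 𝐡 · χ-numerator − σσ only sees m and n modulo h; adding n to m
preserves both Gram determinants Q_χ and Q_γ; scaling m finally detects Q_γ. -/
lemma GenericAt.functionallyIndependentAt {x : Jet} (hx : x ∈ J1) (hg : GenericAt x) :
    FunctionallyIndependentAt invariants x := by
  refine Fintype.linearIndependent_iff.mpr fun l hl => ?_
  have hv (v : Jet) : ∑ i, l i * fderiv ℝ (invariants i) x v = 0 := by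
    simpa using congrArg (fun μ : Jet →L[ℝ] ℝ => μ v) hl
  have hH := detH_ne_zero hx
  have hG := detG_ne_zero hx
  have hinv := mul_nonsing_inv _ (Ne.isUnit hx.2)
  -- The direction is normalized so that the curvature varies by the k-th unit vector.
  have hc (k : Fin 2) : l 4 * (normGrad (hMat (coeff x)) (ehresmann x) k / |detG x|) +
      l 5 * (2 * triple (hMat (x.2.2 0)) (hMat (x.2.2 1)) (ehresmann x) *
        tripleGrad (hMat (x.2.2 0)) (hMat (x.2.2 1)) (ehresmann x) k /
        (|detH x| * |detG x| ^ 3)) = 0 := by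
    have h1 := hv (derivDir 1 0 (Matrix.single 0 k 1 * hMat (coeff x)) 0)
    have hw (s : Fin 2) : hMat ((Pi.single 1 (blockCoeff (0, Matrix.single 0 k 1 * hMat (coeff x), 0)) :
        Fin 2 → Coeff) s) = 0 := by
      rw [hMat_single _ _ _ _ (transpose_zero)]
      fin_cases s <;> simp
    have hk (i : Fin 2) : (fMat ((Pi.single 1 (blockCoeff (0, Matrix.single 0 k 1 * hMat (coeff x), 0)) :
        Fin 2 → Coeff) 1) * (hMat (coeff x))⁻¹) 0 i -
        (fMat ((Pi.single 1 (blockCoeff (0, Matrix.single 0 k 1 * hMat (coeff x), 0)) :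
        Fin 2 → Coeff) 0) * (hMat (coeff x))⁻¹) 1 i = (Pi.single k 1 : Fin 2 → ℝ) i := by
      rw [fMat_single, fMat_single, Pi.single_eq_same, Pi.single_eq_of_ne (by simp),
        Matrix.mul_assoc, hinv]
      simp [Pi.single_apply, Matrix.one_apply, eq_comm]
    simp only [derivDir, Fin.sum_univ_six, fderiv_ellC hx hw hk, fderiv_thetaI_sq hx hw hk,
      fderiv_invariants_zero hx, fderiv_invariants_one hx, fderiv_invariants_two hx,
      fderiv_invariants_three hx, sigVar, chiVar, hw, polar_zero_left, polar_zero_right] at h1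
    simpa using h1
  have hl5 : l 5 = 0 := by
    have h1 := hc 0
    have h2 := hc 1
    set T := triple (hMat (x.2.2 0)) (hMat (x.2.2 1)) (ehresmann x)
    have h3 : l 5 * (2 * T / (|detH x| * |detG x| ^ 3) *
        degen₃ (hMat (coeff x)) (hMat (x.2.2 0)) (hMat (x.2.2 1)) (ehresmann x)) = 0 := by
      unfold degen₃
      linear_combination normGrad (hMat (coeff x)) (ehresmann x) 0 * h2 -
        normGrad (hMat (coeff x)) (ehresmann x) 1 * h1
    refine (mul_eq_zero.mp h3).resolve_right (mul_ne_zero (div_ne_zero ?_ ?_) hg.degen₃_ne)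
    · exact mul_ne_zero two_ne_zero hg.triple_ne
    · exact mul_ne_zero (abs_ne_zero.mpr hH) (pow_ne_zero 3 (abs_ne_zero.mpr hG))
  have hl4 : l 4 = 0 := by
    by_contra h4
    have h1 (k : Fin 2) : normGrad (hMat (coeff x)) (ehresmann x) k = 0 := by
      have h2 := hc k
      rw [hl5, zero_mul, add_zero] at h2
      exact (div_eq_zero_iff.mp ((mul_eq_zero.mp h2).resolve_left h4)).resolve_right
        (abs_ne_zero.mpr hG)
    exact hg.degen₃_ne (by simp [degen₃, h1])
  set g := orbitMetric (coeff x) with hgdef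
  set h := hMat (coeff x) with hhdef
  set m := hMat (x.2.2 0) with hmdef
  set n := hMat (x.2.2 1) with hndef
  have hht : hᵀ = h := hMat_transpose _
  have hmt : mᵀ = m := hMat_transpose _
  have hnt : nᵀ = n := hMat_transpose _
  have hd : h.det = detH x := rfl
  have hd' : polar h h = 2 * detH x := polar_self h
  have hs0 : sig x 0 = polar h m := rfl
  have hs1 : sig x 1 = polar h n := rfl
  have h00 : chiNum x 0 0 = polar m m := rfl
  have h01 : chiNum x 0 1 = polar m n := rfl
  have h11 : chiNum x 1 1 = polar n n := rfl
  have hcomm1 := polar_comm m h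
  have hcomm2 := polar_comm n h
  have hcomm3 := polar_comm n m
  obtain ⟨L0, hL0⟩ : ∃ L, L = l 0 / (detG x * detH x ^ 2) := ⟨_, rfl⟩
  obtain ⟨L1, hL1⟩ : ∃ L, L = l 1 / (2 * detG x * detH x) := ⟨_, rfl⟩
  obtain ⟨L2, hL2⟩ : ∃ L, L = l 2 / (4 * detH x ^ 2 * detG x) := ⟨_, rfl⟩
  obtain ⟨L3, hL3⟩ : ∃ L, L = l 3 / (16 * detH x ^ 4 * detG x) := ⟨_, rfl⟩
  have key (s : Fin 2) (k : Matrix (Fin 2) (Fin 2) ℝ) (hk : kᵀ = k) :=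
    hv (derivDir s 0 0 k)
  simp only [derivDir, Fin.sum_univ_six, hl4, hl5, zero_mul, add_zero,
    fderiv_invariants_zero hx, fderiv_invariants_one hx, fderiv_invariants_two hx,
    fderiv_invariants_three hx, sigVar, chiVar, ← hgdef, ← hhdef, ← hmdef, ← hndef,
    hs0, hs1, h00, h01, h11] at key
  have k1 := key 0 h hht
  have k2 := key 1 h hht
  have k3 := key 0 n hnt
  have k4 := key 0 m hmt
  simp only [hMat_blockCoeff _ _ _ hht, hMat_blockCoeff _ _ _ hmt, hMat_blockCoeff _ _ _ hnt, hMat_zero,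
    Pi.single_eq_same, Pi.single_eq_of_ne (zero_ne_one : (0 : Fin 2) ≠ 1),
    Pi.single_eq_of_ne (one_ne_zero : (1 : Fin 2) ≠ 0), polar_zero_left, polar_zero_right, hd',
    hcomm1, hcomm2, hcomm3] at k1 k2 k3 k4
  set W0 := g 1 1 * polar h m - g 0 1 * polar h n with hW0
  set W1 := g 0 0 * polar h n - g 0 1 * polar h m with hW1
  -- Both σ²-type and χ-type traces change in proportion to `W0` or `W1`, so e1 and e2 form a 2 × 2
  -- system in 2 det 𝐡 · L0 + L1 and L2 with determinant `degen₂`.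
  have e1 : (2 * detH x * L0 + L1) * W0 +
      L2 * (polar h m * polar n n - polar m n * polar h n) = 0 := by
    rw [hL0, hL1, hL2, hW0]; linear_combination (1 / 2) * k1
  have e2 : (2 * detH x * L0 + L1) * W1 +
      L2 * (polar h n * polar m m - polar h m * polar m n) = 0 := by
    rw [hL0, hL1, hL2, hW1]; linear_combination (1 / 2) * k2
  -- Along n neither Q_χ nor Q_γ varies, so only L0 and L1 appear.
  have e3 : L0 * polar h n * W0 + L1 * (g 1 1 * polar m n - g 0 1 * polar n n) = 0 := by
    rw [hL0, hL1, hW0]; linear_combination (1 / 2) * k3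
  have hE2 := hg.degen₂_ne
  simp only [degen₂, ← hgdef, ← hhdef, ← hmdef, ← hndef, ← hW0, ← hW1] at hE2
  have eL2 : L2 = 0 := by
    refine (mul_eq_zero.mp (?_ : L2 * _ = 0)).resolve_right hE2
    linear_combination W0 * e2 - W1 * e1
  have eL01 : 2 * detH x * L0 + L1 = 0 := by
    by_contra hne
    rw [eL2, zero_mul, add_zero] at e1 e2
    rw [(mul_eq_zero.mp e1).resolve_left hne, (mul_eq_zero.mp e2).resolve_left hne] at hE2
    simp at hE2
  have hsym : h 1 0 = h 0 1 ∧ m 1 0 = m 0 1 ∧ n 1 0 = n 0 1 :=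
    ⟨hMat_symm _, hMat_symm _, hMat_symm _⟩
  -- The determinant of the remaining system for L0 and L1 is the very expression that governs the
  -- regularity of the orbits.
  have hdeg1 : degen₁ g h m n =
      polar h n * W0 - 2 * detH x * (g 1 1 * polar m n - g 0 1 * polar n n) := by
    rw [← hd, hW0]
    simp only [degen₁, tri, wedge, polar, det_fin_two, hsym.1, hsym.2.1, hsym.2.2]
    simp
    ring
  have eL0 : L0 = 0 := by
    refine (mul_eq_zero.mp (?_ : L0 * degen₁ g h m n = 0)).resolve_right hg.degen₁_ne
    rw [hdeg1]
    linear_combination e3 - (g 1 1 * polar m n - g 0 1 * polar n n) * eL01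
  have eL1 : L1 = 0 := by simpa [eL0] using eL01
  have z0 : l 0 = 0 := (div_eq_zero_iff.mp (hL0.symm.trans eL0)).resolve_right
    (mul_ne_zero hG (pow_ne_zero 2 hH))
  have z1 : l 1 = 0 := (div_eq_zero_iff.mp (hL1.symm.trans eL1)).resolve_right
    (mul_ne_zero (mul_ne_zero two_ne_zero hG) hH)
  have z2 : l 2 = 0 := (div_eq_zero_iff.mp (hL2.symm.trans eL2)).resolve_right
    (mul_ne_zero (mul_ne_zero four_ne_zero (pow_ne_zero 2 hH)) hG)
  -- The Gram determinant of h, m, n for `polar` is 2 · `tri`²; eliminating h, with `polar h h` = 2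
  -- det 𝐡, turns it into the numerator of Q_γ.
  have hD : 8 * detH x * tri h m n ^ 2 =
      2 * ((2 * detH x * polar m m - polar h m ^ 2) * (2 * detH x * polar n n - polar h n ^ 2) -
        (2 * detH x * polar m n - polar h m * polar h n) ^ 2) := by
    rw [← hd]
    simp only [tri, polar, det_fin_two, hsym.1, hsym.2.1, hsym.2.2]
    ring
  have z3 : l 3 = 0 := by
    have h1 : L3 * (8 * detH x * tri h m n ^ 2) = 0 := by
      rw [z0, z1, z2] at k4
      rw [hD, hL3]
      linear_combination k4
    have h2 := (mul_eq_zero.mp h1).resolve_right (mul_ne_zero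
      (mul_ne_zero (by norm_num) hH) (pow_ne_zero 2 hg.tri_ne))
    exact (div_eq_zero_iff.mp (hL3.symm.trans h2)).resolve_right
      (mul_ne_zero (mul_ne_zero (by norm_num) (pow_ne_zero 4 hH)) hG)
  intro i
  fin_cases i
  exacts [z0, z1, z2, z3, hl4, hl5]

/-! ### Density of the generic jets -/

/-- The matrix `det 𝐡 · g̃`, with polynomial entries. -/
def orbitPoly (c : Coeff) : Matrix (Fin 2) (Fin 2) ℝ := Matrix.of fun i j =>
  bMat c i j * (hMat c).det -
    (fMat c i 0 * fMat c j 0 * hMat c 1 1 - fMat c i 0 * fMat c j 1 * hMat c 0 1 -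
      fMat c i 1 * fMat c j 0 * hMat c 0 1 + fMat c i 1 * fMat c j 1 * hMat c 0 0)

lemma orbitPoly_eq {c : Coeff} (hc : (hMat c).det ≠ 0) :
    orbitPoly c = (hMat c).det • orbitMetric c := by
  ext i j
  simp only [orbitPoly, Matrix.of_apply, Matrix.smul_apply, smul_eq_mul, orbitMetric_apply]
  field_simp

/-- The matrix `(det 𝐡)² D_s f_i^k`, with polynomial entries. -/
def dfUpPoly (s : Fin 2) (x : Jet) : Matrix (Fin 2) (Fin 2) ℝ :=
  ((hMat (coeff x)).det • fMat (x.2.2 s) -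
    fMat (coeff x) * !![hMat (coeff x) 1 1, -hMat (coeff x) 0 1;
      -hMat (coeff x) 1 0, hMat (coeff x) 0 0] * hMat (x.2.2 s)) *
    !![hMat (coeff x) 1 1, -hMat (coeff x) 0 1; -hMat (coeff x) 1 0, hMat (coeff x) 0 0]

lemma dfUpPoly_eq {x : Jet} (hx : (hMat (coeff x)).det ≠ 0) (s : Fin 2) :
    dfUpPoly s x = (hMat (coeff x)).det ^ 2 • dfUp s x := by
  rw [dfUp_eq hx, fUp, inv_hMat, dfUpPoly]
  generalize (!![hMat (coeff x) 1 1, -hMat (coeff x) 0 1;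
      -hMat (coeff x) 1 0, hMat (coeff x) 0 0] : Matrix (Fin 2) (Fin 2) ℝ) = N
  have h : (hMat (coeff x)).det • fMat (x.2.2 s) - fMat (coeff x) * N * hMat (x.2.2 s) =
      (hMat (coeff x)).det • (fMat (x.2.2 s) -
        (hMat (coeff x)).det⁻¹ • (fMat (coeff x) * N * hMat (x.2.2 s))) := by
    rw [smul_sub, smul_smul, mul_inv_cancel₀ hx, one_smul]
  rw [h, Matrix.mul_smul, Matrix.mul_smul, Matrix.smul_mul, Matrix.smul_mul, smul_smul]
  congr 1
  field_simp

/-- The components `(det 𝐡)² (f^k_{1,2} - f^k_{2,1})`, polynomials in the jet coordinates. -/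
def curvPoly (x : Jet) (k : Fin 2) : ℝ := dfUpPoly 1 x 0 k - dfUpPoly 0 x 1 k

lemma curvPoly_eq {x : Jet} (hx : (hMat (coeff x)).det ≠ 0) :
    curvPoly x = (hMat (coeff x)).det ^ 2 • ehresmann x := by
  ext k
  simp only [curvPoly, dfUpPoly_eq hx, ehresmann_eq, Matrix.smul_apply, Pi.smul_apply, smul_eq_mul]
  ring

/-- A polynomial in the jet coordinates that does not vanish at generic jets only. -/
def genericPoly (x : Jet) : ℝ :=
  tri (hMat (coeff x)) (hMat (x.2.2 0)) (hMat (x.2.2 1)) *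
  degen₁ (orbitPoly (coeff x)) (hMat (coeff x)) (hMat (x.2.2 0)) (hMat (x.2.2 1)) *
  degen₂ (orbitPoly (coeff x)) (hMat (coeff x)) (hMat (x.2.2 0)) (hMat (x.2.2 1)) *
  triple (hMat (x.2.2 0)) (hMat (x.2.2 1)) (curvPoly x) *
  degen₃ (hMat (coeff x)) (hMat (x.2.2 0)) (hMat (x.2.2 1)) (curvPoly x)

/-- Clearing denominators only introduces powers of det 𝐡, as `degen₁` and `degen₂` are linear in g̃
while `triple` and `degen₃` are quadratic in the curvature. The resulting polynomial lives on the
whole connected jet space. -/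
lemma genericAt_of_genericPoly {x : Jet} (hx : x ∈ J1) (h : genericPoly x ≠ 0) : GenericAt x := by
  have h1 (r : ℝ) (g h m n) : degen₁ (r • g) h m n = r * degen₁ g h m n := by
    simp only [degen₁, Matrix.smul_apply, smul_eq_mul]; ring
  have h2 (r : ℝ) (g h m n) : degen₂ (r • g) h m n = r * degen₂ g h m n := by
    simp only [degen₂, Matrix.smul_apply, smul_eq_mul]; ring
  have h3 (r : ℝ) (h m n c) : degen₃ h m n (r • c) = r ^ 2 * degen₃ h m n c := by
    simp [degen₃, normGrad, tripleGrad]; ring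
  simp only [genericPoly, orbitPoly_eq hx.2, curvPoly_eq hx.2, h1, h2, h3, triple_smul,
    mul_ne_zero_iff] at h
  obtain ⟨⟨⟨⟨a, -, b⟩, -, c⟩, -, d⟩, -, e⟩ := h
  exact ⟨a, b, c, d, e⟩

lemma contDiff_orbitPoly {n : WithTop ℕ∞} (i j : Fin 2) :
    ContDiff ℝ n fun x : Jet => orbitPoly (coeff x) i j := by
  have h : ContDiff ℝ n fun x : Jet => (hMat (coeff x)).det := contDiff_detH
  simp only [orbitPoly, Matrix.of_apply]
  fun_prop

lemma contDiff_curvPoly {n : WithTop ℕ∞} (k : Fin 2) :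
    ContDiff ℝ n fun x : Jet => curvPoly x k := by
  have h : ContDiff ℝ n fun x : Jet => (hMat (coeff x)).det := contDiff_detH
  have hN (i j : Fin 2) : ContDiff ℝ n fun x : Jet => (!![hMat (coeff x) 1 1, -hMat (coeff x) 0 1;
      -hMat (coeff x) 1 0, hMat (coeff x) 0 0] : Matrix (Fin 2) (Fin 2) ℝ) i j := by
    fin_cases i <;> fin_cases j <;> simp <;> fun_prop
  simp only [curvPoly, dfUpPoly, Matrix.mul_apply, Matrix.sub_apply, Matrix.smul_apply, smul_eq_mul]
  fun_prop

lemma contDiff_genericPoly {n : WithTop ℕ∞} : ContDiff ℝ n genericPoly := by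
  have ho (i j : Fin 2) := contDiff_orbitPoly (n := n) i j
  have hc (k : Fin 2) := contDiff_curvPoly (n := n) k
  unfold genericPoly
  refine ((((ContDiff.mul ?_ ?_).mul ?_).mul ?_).mul ?_)
  · unfold tri; fun_prop
  · simp only [degen₁, tri, wedge, Matrix.of_apply, Matrix.cons_val', Matrix.cons_val_zero,
      Matrix.cons_val_one, Matrix.cons_val_fin_one]
    fun_prop
  · simp only [degen₂, polar]
    fun_prop
  · simp only [triple, det_fin_three]
    simp
    fun_prop
  · simp [degen₃, normGrad, tripleGrad]
    fun_prop

/-- A jet at which the invariants are independent. -/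
def exampleJet : Jet :=
  (0, blockCoeff (1, 0, 1), ![blockCoeff (0, 0, !![0, 0; 0, 1]),
    blockCoeff (0, Matrix.single 0 1 1, !![1, 1; 1, 0])])

lemma genericPoly_exampleJet : genericPoly exampleJet ≠ 0 := by
  have t1 : (!![0, 0; 0, 1] : Matrix (Fin 2) (Fin 2) ℝ)ᵀ = !![0, 0; 0, 1] := by
    ext i j; fin_cases i <;> fin_cases j <;> simp
  have t2 : (!![1, 1; 1, 0] : Matrix (Fin 2) (Fin 2) ℝ)ᵀ = !![1, 1; 1, 0] := by
    ext i j; fin_cases i <;> fin_cases j <;> simp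
  have hc : coeff exampleJet = blockCoeff (1, 0, 1) := rfl
  have h0 : exampleJet.2.2 0 = blockCoeff (0, 0, !![0, 0; 0, 1]) := rfl
  have h1 : exampleJet.2.2 1 = blockCoeff (0, Matrix.single 0 1 1, !![1, 1; 1, 0]) := rfl
  have ho : orbitPoly (blockCoeff (1, 0, 1)) = 1 := by
    ext i j
    simp [orbitPoly, hMat_blockCoeff, bMat_blockCoeff, fMat_blockCoeff]
  have hp : curvPoly exampleJet = ![0, 1] := by
    ext k
    fin_cases k <;>
      simp [curvPoly, dfUpPoly, hc, h0, h1, hMat_blockCoeff, fMat_blockCoeff, Matrix.mul_apply]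
  simp only [genericPoly, hp, hc, h0, h1, ho, hMat_blockCoeff _ _ _ t1, hMat_blockCoeff _ _ _ t2,
    hMat_blockCoeff _ _ _ transpose_one]
  refine mul_ne_zero (mul_ne_zero (mul_ne_zero (mul_ne_zero ?_ ?_) ?_) ?_) ?_
  · simp [tri]
  · norm_num [degen₁, tri, wedge, Matrix.one_apply]
  · norm_num [degen₂, polar, Matrix.one_apply]
  · simp [triple, det_fin_three]
  · norm_num [degen₃, normGrad, tripleGrad, Matrix.one_apply]

lemma dense_genericPoly_ne_zero : Dense {x | genericPoly x ≠ 0} := by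
  intro x
  rw [mem_closure_iff_frequently]
  intro h
  have h1 : genericPoly =ᶠ[nhds x] fun _ => 0 := by
    filter_upwards [h] with y hy
    simpa using hy
  -- Identity theorem: an analytic function vanishing near one point of a vector space vanishes
  -- identically.
  have h2 := (contDiff_omega_iff_analyticOnNhd.mp (contDiff_genericPoly (n := ω))).eq_of_eventuallyEq
    (fun _ _ => analyticAt_const) h1
  exact genericPoly_exampleJet (congrFun h2 _)

lemma isOpen_genericPoly_ne_zero : IsOpen {x | genericPoly x ≠ 0} :=
  isOpen_ne_fun (contDiff_genericPoly (n := 0)).continuous continuous_const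

lemma isOpen_intransitiveJ1 : IsOpen intransitiveJ1 := by
  have h : ContinuousOn ehresmann J1 := fun x hx =>
    ContinuousAt.continuousWithinAt (continuousAt_pi.mpr fun k =>
      (contDiffAt_ehresmann (n := 0) hx k).continuousAt)
  exact h.isOpen_inter_preimage isOpen_J1 isOpen_ne

lemma genericallyIndependentOn_invariants : GenericallyIndependentOn invariants intransitiveJ1 :=
  ⟨intransitiveJ1 ∩ {x | genericPoly x ≠ 0},
    isOpen_intransitiveJ1.inter isOpen_genericPoly_ne_zero, Set.inter_subset_left,
    dense_genericPoly_ne_zero.open_subset_closure_inter isOpen_intransitiveJ1,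
    fun _ hx => (genericAt_of_genericPoly hx.1.1 hx.2).functionallyIndependentAt hx.1.1⟩

/-- Independence at one jet would persist on an open subset of U; this subset contains a generic,
hence regular, jet, where seven invariants are always dependent. -/
lemma not_functionallyIndependentAt_snoc {U : Set Jet} {F : Jet → ℝ} (hU : IsOpen U)
    (hJ : U ⊆ J1) (hF : IsInvariant U F) {x : Jet} (hx : x ∈ U) :
    ¬ FunctionallyIndependentAt (Fin.snoc invariants F : Fin 7 → Jet → ℝ) x := by
  intro hli
  have hI (i : Fin 7) : IsInvariant U ((Fin.snoc invariants F : Fin 7 → Jet → ℝ) i) := by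
    refine Fin.lastCases (motive := fun i =>
      IsInvariant U ((Fin.snoc invariants F : Fin 7 → Jet → ℝ) i)) ?_ (fun j => ?_) i
    · rw [Fin.snoc_last]; exact hF
    · rw [Fin.snoc_castSucc]; exact (isInvariant_invariants j).mono hJ
  obtain ⟨y, hy, hy'⟩ := dense_genericPoly_ne_zero.inter_open_nonempty _
    (isOpen_setOf_functionallyIndependentAt hU fun i => (hI i).smooth) ⟨x, hx, hli⟩
  exact not_functionallyIndependentAt hU hJ hI hy.1
    (genericAt_of_genericPoly (hJ hy.1) hy').regularAt hy.2

end KillingJet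
end

/-- In the orthogonally intransitive case, `C_ρ, C_χ, Q_χ, Q_γ, ℓ_𝒞, (Θ_I)²` form a maximal system
of generically functionally independent first-order scalar differential invariants. -/
theorem mainTheorem4 :
    (∀ i, KillingJet.IsInvariant KillingJet.J1 (KillingJet.invariants i)) ∧
    KillingJet.GenericallyIndependentOn KillingJet.invariants KillingJet.intransitiveJ1 ∧
    (∀ (U : Set KillingJet.Jet) (F : KillingJet.Jet → ℝ),
      IsOpen U → U ⊆ KillingJet.J1 → KillingJet.IsInvariant U F →
      ∀ x ∈ U, ¬ KillingJet.FunctionallyIndependentAt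
        (Fin.snoc KillingJet.invariants F : Fin 7 → KillingJet.Jet → ℝ) x) :=
  ⟨KillingJet.isInvariant_invariants, KillingJet.genericallyIndependentOn_invariants,
    fun _ _ hU hJ hF _ hx => KillingJet.not_functionallyIndependentAt_snoc hU hJ hF hx⟩
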